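/- Let $d\ge 1$ and let $\varphi\in\mathcal S(\mathbb R^d;\mathbb R)$ be a Schwartz function with $\int_{\mathbb R^d}\varphi\,dx=1$; write $\varphi_\delta(x)=\delta^{-d}\varphi(x/\delta)$ for $\delta>0$. For a vector field $u:\mathbb R^d\to\mathbb R^d$ and a scalar $\rho:\mathbb R^d\to\mathbb R$ let $$R_\delta(u,\rho)(x)=u(x)\cdot\nabla(\rho*\varphi_\delta)(x)-\nabla\cdot\big((u\rho)*\varphi_\delta\big)(x)$$ be the DiPerna–Lions commutator. Let $p,q\in(1,\infty]$ with $\frac1p+\frac1q=1$ (so that in fact $1<p,q<\infty$). Then for every $\epsilon>0$ and every $\bar\delta>0$ there exists $\delta_\epsilon\in(0,\bar\delta]$ (depending only on $d,\varphi,p,q,\epsilon,\bar\delta$) such that for every $u\in W^{1,p}(\mathbb R^d;\mathbb R^d)$ which is divergence-free in the sense of distributions and every $\rho\in L^q(\mathbb R^d;\mathbb R)$, $$\inf_{\delta\in[\delta_\epsilon,\bar\delta]}\left\|R_\delta(u,\rho)\right\|_{L^1(\mathbb R^d)}\le\epsilon\left\|\nabla u\right\|_{L^p(\mathbb R^d)}\left\|\rho\right\|_{L^q(\mathbb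 R^d)}.$$ Here $\nabla u$ is the weak gradient, and its $L^p$ norm is taken with the operator norm of the matrix $\nabla u(x)$. -/

import Mathlib

open MeasureTheory Set
open scoped ENNReal SchwartzMap ContDiff Convolution

noncomputable section

namespace DiPernaLions

/-- The rescaled mollifier `φ_δ(x) = δ^{-d} φ(x / δ)` on `ℝ^d`. -/
def rescale {d : ℕ} (φ : EuclideanSpace ℝ (Fin d) → ℝ) (δ : ℝ) :
    EuclideanSpace ℝ (Fin d) → ℝ :=
  fun x => (δ ^ d)⁻¹ * φ (δ⁻¹ • x)

/-- The (pointwise, classical) divergence `∑ i, ∂_i V_i` of a vector field on `ℝ^d`. -/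
def divergence {d : ℕ} (V : EuclideanSpace ℝ (Fin d) → EuclideanSpace ℝ (Fin d))
    (x : EuclideanSpace ℝ (Fin d)) : ℝ :=
  ∑ i : Fin d, (fderiv ℝ V x (EuclideanSpace.single i 1)) i

/-- The convolution `ρ * K` of two scalar functions, `(ρ * K)(x) = ∫ ρ(y) K(x - y) dy`. -/
def convScalar {d : ℕ} (ρ K : EuclideanSpace ℝ (Fin d) → ℝ) :
    EuclideanSpace ℝ (Fin d) → ℝ :=
  ρ ⋆[ContinuousLinearMap.lsmul ℝ ℝ, volume] K

/-- The convolution `V * K` of a vector field with a scalar kernel,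
`(V * K)(x) = ∫ K(x - y) V(y) dy`. -/
def convVector {d : ℕ} (V : EuclideanSpace ℝ (Fin d) → EuclideanSpace ℝ (Fin d))
    (K : EuclideanSpace ℝ (Fin d) → ℝ) :
    EuclideanSpace ℝ (Fin d) → EuclideanSpace ℝ (Fin d) :=
  V ⋆[(ContinuousLinearMap.lsmul ℝ ℝ).flip, volume] K

/-- The DiPerna–Lions commutator
`R_δ(u, ρ)(x) = u(x) · ∇(ρ * φ_δ)(x) - ∇ · ((u ρ) * φ_δ)(x)`.
The two mollified functions are smooth for the `u`, `ρ` and Schwartz `φ` considered below, so the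
derivatives are classical ones; `u(x) · ∇g(x)` is the derivative of `g` at `x` applied to `u(x)`. -/
def commutator {d : ℕ} (φ : EuclideanSpace ℝ (Fin d) → ℝ) (δ : ℝ)
    (u : EuclideanSpace ℝ (Fin d) → EuclideanSpace ℝ (Fin d))
    (ρ : EuclideanSpace ℝ (Fin d) → ℝ) (x : EuclideanSpace ℝ (Fin d)) : ℝ :=
  fderiv ℝ (convScalar ρ (rescale φ δ)) x (u x) -
    divergence (convVector (fun y => ρ y • u y) (rescale φ δ)) x

/-- `G` is the weak gradient of the vector field `u`: both are locally integrable and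
`∫ (∂_v ψ) u = - ∫ ψ (G v)` for every test function `ψ ∈ C_c^∞(ℝ^d)` and every direction `v`.
The matrix of `G x` is `(∂_j u_i(x))_{i,j}`. -/
structure IsWeakGradient {d : ℕ} (u : EuclideanSpace ℝ (Fin d) → EuclideanSpace ℝ (Fin d))
    (G : EuclideanSpace ℝ (Fin d) → EuclideanSpace ℝ (Fin d) →L[ℝ] EuclideanSpace ℝ (Fin d)) :
    Prop where
  locallyIntegrable : LocallyIntegrable u volume
  locallyIntegrable_gradient : LocallyIntegrable G volume
  integral_eq : ∀ ψ : EuclideanSpace ℝ (Fin d) → ℝ, ContDiff ℝ ∞ ψ → HasCompactSupport ψ →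
    ∀ v : EuclideanSpace ℝ (Fin d),
      ∫ x, (fderiv ℝ ψ x v) • u x = - ∫ x, ψ x • G x v

/-- A vector field is divergence-free if it is locally integrable and its distributional
divergence vanishes: `∫ u · ∇ψ = 0` for every `ψ ∈ C_c^∞(ℝ^d)`. -/
structure IsDivergenceFree {d : ℕ}
    (u : EuclideanSpace ℝ (Fin d) → EuclideanSpace ℝ (Fin d)) : Prop where
  locallyIntegrable : LocallyIntegrable u volume
  integral_eq_zero : ∀ ψ : EuclideanSpace ℝ (Fin d) → ℝ, ContDiff ℝ ∞ ψ → HasCompactSupport ψ →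
    ∫ x, fderiv ℝ ψ x (u x) = 0

end DiPernaLions

end

/-!
Write `u(x) · ∇(ρ * φ_δ)(x) - ∇ · ((u ρ) * φ_δ)(x) = ∫ ρ(x + z) k_δ(z) · (u(x + z) - u(x)) dz` with
`k_δ(z) = -∇φ_δ(-z)` (`commutator_eq_kernelCommutator`). Since `‖u(· + h) - u‖_p ≤ |h| ‖∇u‖_p`
(`IsWeakGradient.lpLipschitz`) and `∫ |z| |k_δ(z)| dz` does not depend on `δ`, the commutator is bounded
in `L^1` by `‖∇u‖_p ‖ρ‖_q`, uniformly in `δ`. Two kinds of densities give a small commutator.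

* If `ρ` is nearly constant at scale `δ`, then the commutator is small, because
  `∫ k_δ(z) · (u(x + z) - u(x)) dz = 0`: this is where `∇ · u = 0` enters
  (`IsDivergenceFree.integral_gradientKernel`, `lintegral_kernelCommutator_le`).
* If `ρ = f - A_r f`, with `A_r` the average over balls of radius `r` much smaller than `δ`, then the
  shift in `A_r` can be moved onto the kernel `k_δ(z) · (u(x + z) - u(x))`, which gains a factor
  `r / δ` (`lintegral_kernelCommutator_sub_average_le`).

A general `ρ` splits into such parts at one of finitely many scales. Take radii `r_0 < r_1 < …` in
geometric progression with a large ratio, `ρ_0 = ρ` and `ρ_{j+1} = A_{r_j} ρ_j`. The norms `‖ρ_j‖_q`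
decrease, so that for one of the first `N` indices `j` the difference `‖ρ_j‖_q^q - ‖ρ_{j+1}‖_q^q` is at
most `‖ρ‖_q^q / N`. This difference is the integrated gap in Jensen's inequality, and by the strict
convexity of `t ↦ |t| ^ q` (`exists_uniform_convexity`; here `1 < q < ∞` is used) a small gap forces
`ρ_j(x + w)` to be close to `ρ_{j+1}(x)` for most `|w| ≤ r_j`
(`exists_nearly_constant_average`). Choosing `δ` a large factor below `r_j`, the part `ρ_j` is
nearly constant at scale `δ`, while the remaining part `ρ - ρ_j` is the sum of the fluctuations
`ρ_i - ρ_{i+1}`, `i < j`, at scales far below `δ` (`exists_scale_kernelCommutator_le`).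
-/

noncomputable section

namespace DiPernaLions

set_option linter.unusedSectionVars false

/-! ### Quantitative strict convexity of the power function -/

lemma midpoint_rpow_lt {q : ℝ} (hq : 1 < q) {a b : ℝ} (hab : a ≠ b) :
    |(a + b) / 2| ^ q < (|a| ^ q + |b| ^ q) / 2 := by
  have hq0 : 0 < q := by linarith
  by_cases h : |a| = |b|
  · rcases abs_eq_abs.1 h with h' | h'
    · exact absurd h' hab
    · have hb : b ≠ 0 := by
        rintro rfl
        exact hab (by simpa using h')
      have : 0 < |b| ^ q := Real.rpow_pos_of_pos (abs_pos.2 hb) q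
      rw [h, h']
      simp [Real.zero_rpow hq0.ne']
      linarith
  · have h1 := (strictConvexOn_rpow hq).2 (abs_nonneg a) (abs_nonneg b) h
      (by norm_num : (0 : ℝ) < 1 / 2) (by norm_num : (0 : ℝ) < 1 / 2) (by norm_num)
    simp only [smul_eq_mul] at h1
    have h2 : |(a + b) / 2| ≤ 1 / 2 * |a| + 1 / 2 * |b| := by
      rw [abs_div, abs_two]
      have := abs_add_le a b
      linarith
    have h3 := Real.rpow_le_rpow (abs_nonneg _) h2 hq0.le
    linarith

/-- A quantitative form of the strict convexity of `t ↦ |t| ^ q`: the distance `|b - a| ^ q` is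
controlled by the midpoint convexity gap, up to an arbitrarily small multiple of
`|a| ^ q + |b| ^ q`. The inequality is arranged so that all terms are nonnegative. -/
lemma exists_uniform_convexity {q : ℝ} (hq : 1 < q) {η : ℝ} (hη : 0 < η) :
    ∃ C : ℝ, 0 < C ∧ ∀ a b : ℝ,
      |b - a| ^ q + C * |(a + b) / 2| ^ q ≤ (η + C / 2) * (|a| ^ q + |b| ^ q) := by
  have hq0 : 0 < q := by linarith
  set D : ℝ × ℝ → ℝ := fun x => (|x.1| ^ q + |x.2| ^ q) / 2 - |(x.1 + x.2) / 2| ^ q with hD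
  have hDc : Continuous D := by
    have : ∀ g : ℝ × ℝ → ℝ, Continuous g → Continuous fun x => |g x| ^ q := fun g hg =>
      hg.abs.rpow_const fun _ => Or.inr hq0.le
    exact (((this _ continuous_fst).add (this _ continuous_snd)).div_const 2).sub
      (this (fun x => (x.1 + x.2) / 2) (by fun_prop))
  have hDpos : ∀ a b : ℝ, a ≠ b → 0 < D (a, b) := fun a b hab => sub_pos.2 (midpoint_rpow_lt hq hab)
  have hDnonneg : ∀ a b : ℝ, 0 ≤ D (a, b) := by
    intro a b
    by_cases h : a = b
    · subst h
      simp [hD]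
    · exact (hDpos a b h).le
  -- it is enough to treat the unit sphere of the maximum norm, by homogeneity
  suffices H : ∃ C : ℝ, 0 < C ∧ ∀ a b : ℝ, max |a| |b| = 1 →
      |b - a| ^ q ≤ η + C * D (a, b) by
    obtain ⟨C, hC, H⟩ := H
    refine ⟨C, hC, fun a b => ?_⟩
    set t := max |a| |b| with ht
    have ht0 : 0 ≤ t := le_max_of_le_left (abs_nonneg a)
    rcases ht0.eq_or_lt with h0 | h0
    · have ha : a = 0 := abs_eq_zero.1 (le_antisymm (h0 ▸ le_max_left _ _) (abs_nonneg a))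
      have hb : b = 0 := abs_eq_zero.1 (le_antisymm (h0 ▸ le_max_right _ _) (abs_nonneg b))
      simp [ha, hb, Real.zero_rpow hq0.ne']
    · have h1 : max |a / t| |b / t| = 1 := by
        rw [abs_div, abs_div, abs_of_pos h0, max_div_div_right h0.le, ← ht, div_self h0.ne']
      have key := H _ _ h1
      have sc : ∀ c : ℝ, |c / t| ^ q = |c| ^ q / t ^ q := fun c => by
        rw [abs_div, abs_of_pos h0, Real.div_rpow (abs_nonneg _) h0.le]
      have htq : 0 < t ^ q := Real.rpow_pos_of_pos h0 q
      have e1 : b / t - a / t = (b - a) / t := by ring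
      have e2 : (a / t + b / t) / 2 = ((a + b) / 2) / t := by ring
      simp only [hD] at key
      rw [e1, e2, sc, sc, sc, sc, div_le_iff₀ htq] at key
      have e3 : (η + C * ((|a| ^ q / t ^ q + |b| ^ q / t ^ q) / 2 - |(a + b) / 2| ^ q / t ^ q))
          * t ^ q = η * t ^ q + C * ((|a| ^ q + |b| ^ q) / 2 - |(a + b) / 2| ^ q) := by
        field_simp
      rw [e3] at key
      have h4 : t ^ q ≤ |a| ^ q + |b| ^ q := by
        have := Real.rpow_nonneg (abs_nonneg a) q
        have := Real.rpow_nonneg (abs_nonneg b) q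
        rcases max_choice |a| |b| with h | h <;> rw [ht, h] <;> linarith
      have := mul_le_mul_of_nonneg_left h4 hη.le
      linarith
  set K : Set (ℝ × ℝ) := Metric.sphere 0 1 ∩ {x | η ≤ |x.2 - x.1| ^ q} with hK
  have hKc : IsCompact K := by
    refine (isCompact_sphere _ _).inter_right (isClosed_le continuous_const ?_)
    exact (continuous_snd.sub continuous_fst).abs.rpow_const fun _ => Or.inr hq0.le
  have hmem : ∀ a b : ℝ, max |a| |b| = 1 → η ≤ |b - a| ^ q → (a, b) ∈ K := by
    intro a b h h'
    exact ⟨by simpa [Prod.norm_def] using h, h'⟩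
  rcases K.eq_empty_or_nonempty with h | h
  · refine ⟨1, one_pos, fun a b hab => ?_⟩
    have := hDnonneg a b
    by_contra hcon
    have : (a, b) ∈ K := hmem a b hab (by linarith)
    simp [h] at this
  · obtain ⟨x, hx, hmin⟩ := hKc.exists_isMinOn h hDc.continuousOn
    have hm : 0 < D x := by
      refine hDpos x.1 x.2 fun hx' => ?_
      have := hx.2
      simp [hx', Real.zero_rpow hq0.ne'] at this
      linarith
    refine ⟨2 ^ q / D x, by positivity, fun a b hab => ?_⟩
    have hn := hDnonneg a b
    rcases le_or_gt η (|b - a| ^ q) with h1 | h1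
    · have h2 : D x ≤ D (a, b) := hmin (hmem a b hab h1)
      have h3 : |b - a| ≤ 2 := by
        have := abs_sub b a
        have := le_max_left |a| |b|
        have := le_max_right |a| |b|
        linarith
      have h4 := Real.rpow_le_rpow (abs_nonneg _) h3 hq0.le
      have h5 : (2 : ℝ) ^ q ≤ 2 ^ q / D x * D (a, b) := by
        rw [div_mul_eq_mul_div, le_div_iff₀ hm]
        gcongr
      linarith
    · have : 0 ≤ 2 ^ q / D x * D (a, b) := by positivity
      linarith

/-! ### Successive averages of an `L^q` function -/

section

/-- Jensen's inequality for the power `t ↦ t ^ q` and a probability measure. -/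
lemma rpow_lintegral_le {α : Type*} [MeasurableSpace α] (ν : Measure α) [IsProbabilityMeasure ν]
    {q : ℝ} (hq : 1 ≤ q) {g : α → ℝ≥0∞} (hg : Measurable g) :
    (∫⁻ w, g w ∂ν) ^ q ≤ ∫⁻ w, g w ^ q ∂ν := by
  have hq0 : 0 < q := by linarith
  have h := eLpNorm_le_eLpNorm_of_exponent_le (μ := ν) (f := g) (p := 1) (q := ENNReal.ofReal q)
    (by simpa using ENNReal.ofReal_le_ofReal hq) hg.aestronglyMeasurable
  rw [eLpNorm_one_eq_lintegral_enorm, eLpNorm_eq_lintegral_rpow_enorm_toReal (by simpa using hq0)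
    (by simp), ENNReal.toReal_ofReal hq0.le] at h
  simp only [enorm_eq_self] at h
  have h' := ENNReal.rpow_le_rpow h hq0.le
  rwa [← ENNReal.rpow_mul, one_div_mul_cancel hq0.ne', ENNReal.rpow_one] at h'

variable {E : Type*} [NormedAddCommGroup E] [SecondCountableTopology E] [MeasurableSpace E]
  [BorelSpace E]

/-- The average `x ↦ ∫ f (x + w) dν(w)` of `f` along a (probability) measure `ν`. -/
def average (ν : Measure E) (f : E → ℝ) (x : E) : ℝ := ∫ w, f (x + w) ∂ν

lemma measurable_average (ν : Measure E) [SFinite ν] {f : E → ℝ} (hf : Measurable f) :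
    Measurable (average ν f) := by
  have : StronglyMeasurable (Function.uncurry fun x w : E => f (x + w)) :=
    (hf.comp (measurable_fst.add measurable_snd)).stronglyMeasurable
  exact this.integral_prod_right.measurable

variable (μ : Measure E) [SFinite μ] [μ.IsAddRightInvariant]
  (ν : Measure E) [IsProbabilityMeasure ν]

lemma lintegral_lintegral_add {g : E → ℝ≥0∞} (hg : Measurable g) :
    ∫⁻ x, ∫⁻ w, g (x + w) ∂ν ∂μ = ∫⁻ x, g x ∂μ := by
  have hm : Measurable (Function.uncurry fun x w : E => g (x + w)) :=
    hg.comp (measurable_fst.add measurable_snd)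
  rw [lintegral_lintegral_swap hm.aemeasurable]
  simp [lintegral_add_right_eq_self]

lemma enorm_average_rpow_le {q : ℝ} (hq : 1 ≤ q) {f : E → ℝ} (hf : Measurable f) (x : E) :
    ‖average ν f x‖ₑ ^ q ≤ ∫⁻ w, ‖f (x + w)‖ₑ ^ q ∂ν := by
  have hm : Measurable fun w => ‖f (x + w)‖ₑ := (hf.comp (measurable_const.add measurable_id)).enorm
  exact (ENNReal.rpow_le_rpow (enorm_integral_le_lintegral_enorm _) (by linarith)).trans
    (rpow_lintegral_le ν hq hm)

lemma lintegral_average_rpow_le {q : ℝ} (hq : 1 ≤ q) {f : E → ℝ} (hf : Measurable f) :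
    ∫⁻ x, ‖average ν f x‖ₑ ^ q ∂μ ≤ ∫⁻ x, ‖f x‖ₑ ^ q ∂μ :=
  (lintegral_mono fun x => enorm_average_rpow_le ν hq hf x).trans
    (lintegral_lintegral_add μ ν (hf.enorm.pow_const q)).le

lemma ae_integrable_add {q : ℝ} (hq : 1 ≤ q) {f : E → ℝ} (hf : Measurable f)
    (hfin : ∫⁻ x, ‖f x‖ₑ ^ q ∂μ ≠ ⊤) : ∀ᵐ x ∂μ, Integrable (fun w => f (x + w)) ν := by
  have hq0 : 0 < q := by linarith
  have hm : Measurable (Function.uncurry fun x w : E => ‖f (x + w)‖ₑ ^ q) :=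
    (hf.comp (measurable_fst.add measurable_snd)).enorm.pow_const q
  rw [← lintegral_lintegral_add μ ν (hf.enorm.pow_const q)] at hfin
  filter_upwards [ae_lt_top hm.lintegral_prod_right' hfin] with x hx
  have hm' : Measurable fun w => f (x + w) := hf.comp (measurable_const.add measurable_id)
  refine ⟨hm'.aestronglyMeasurable, ?_⟩
  have h := (rpow_lintegral_le ν hq hm'.enorm).trans_lt hx
  exact (ENNReal.rpow_lt_top_iff_of_pos hq0).1 h

/-- If averaging along `ν` hardly decreases the `L^q` norm of `f`, then `f (x + w)` is close to the
average of `f` at `x`, for most `w`: this is the quantitative strict convexity of `t ↦ |t| ^ q`,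
integrated. The constants `η` and `C` are those of `exists_uniform_convexity`. -/
lemma lintegral_sub_average_add_le {q : ℝ} (hq : 1 ≤ q) {η C : ℝ} (hη : 0 ≤ η) (hC : 0 ≤ C)
    (H : ∀ a b : ℝ, |b - a| ^ q + C * |(a + b) / 2| ^ q ≤ (η + C / 2) * (|a| ^ q + |b| ^ q))
    {f : E → ℝ} (hf : Measurable f) (hfin : ∫⁻ x, ‖f x‖ₑ ^ q ∂μ ≠ ⊤) :
    (∫⁻ x, ∫⁻ w, ‖f (x + w) - average ν f x‖ₑ ^ q ∂ν ∂μ)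
        + ENNReal.ofReal C * ∫⁻ x, ‖average ν f x‖ₑ ^ q ∂μ
      ≤ ENNReal.ofReal (η + C / 2) *
        (∫⁻ x, ‖average ν f x‖ₑ ^ q ∂μ + ∫⁻ x, ‖f x‖ₑ ^ q ∂μ) := by
  have hq0 : 0 < q := by linarith
  have ha := measurable_average ν hf
  have hfs : Measurable fun z : E × E => f (z.1 + z.2) := hf.comp (measurable_fst.add measurable_snd)
  have hfx : ∀ x, Measurable fun w => f (x + w) := fun x => hf.comp (measurable_const.add measurable_id)
  have hpow : ∀ c : ℝ, ‖c‖ₑ ^ q = ENNReal.ofReal (|c| ^ q) := fun c => by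
    rw [← ofReal_norm, ENNReal.ofReal_rpow_of_nonneg (norm_nonneg _) hq0.le,
      Real.norm_eq_abs]
  have H' : ∀ a b : ℝ, ‖b - a‖ₑ ^ q + ENNReal.ofReal C * ‖(a + b) / 2‖ₑ ^ q
      ≤ ENNReal.ofReal (η + C / 2) * (‖a‖ₑ ^ q + ‖b‖ₑ ^ q) := fun a b => by
    have h0 : ∀ c : ℝ, 0 ≤ |c| ^ q := fun c => Real.rpow_nonneg (abs_nonneg c) q
    rw [hpow, hpow, hpow, hpow, ← ENNReal.ofReal_mul hC, ← ENNReal.ofReal_add (h0 _)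
      (mul_nonneg hC (h0 _)), ← ENNReal.ofReal_add (h0 _) (h0 _),
      ← ENNReal.ofReal_mul (by positivity)]
    exact ENNReal.ofReal_le_ofReal (H a b)
  have hJ : ∀ᵐ x ∂μ, ‖average ν f x‖ₑ ^ q
      ≤ ∫⁻ w, ‖(average ν f x + f (x + w)) / 2‖ₑ ^ q ∂ν := by
    filter_upwards [ae_integrable_add μ ν hq hf hfin] with x hx
    have e : average ν f x = ∫ w, (average ν f x + f (x + w)) / 2 ∂ν := by
      rw [integral_div, integral_add (integrable_const _) hx]
      simp only [integral_const, probReal_univ, one_smul]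
      change _ = (average ν f x + average ν f x) / 2
      ring
    have hmx : Measurable fun w => ‖(average ν f x + f (x + w)) / 2‖ₑ :=
      (((hfx x).const_add _).div_const 2).enorm
    have h1 : ‖average ν f x‖ₑ ≤ ∫⁻ w, ‖(average ν f x + f (x + w)) / 2‖ₑ ∂ν :=
      (congrArg enorm e).le.trans (enorm_integral_le_lintegral_enorm _)
    exact (ENNReal.rpow_le_rpow h1 hq0.le).trans (rpow_lintegral_le ν hq hmx)
  have hm1 : Measurable fun z : E × E => ‖(average ν f z.1 + f (z.1 + z.2)) / 2‖ₑ ^ q :=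
    ((((ha.comp measurable_fst).add hfs).div_const 2).enorm).pow_const q
  have hm2 : Measurable fun z : E × E => ‖f (z.1 + z.2) - average ν f z.1‖ₑ ^ q :=
    (hfs.sub (ha.comp measurable_fst)).enorm.pow_const q
  have hm2' : Measurable fun x => ∫⁻ w, ‖f (x + w) - average ν f x‖ₑ ^ q ∂ν :=
    hm2.lintegral_prod_right'
  have hm3 : Measurable fun z : E × E => ‖f (z.1 + z.2)‖ₑ ^ q := hfs.enorm.pow_const q
  have hm4 : Measurable fun x => ‖average ν f x‖ₑ ^ q + ∫⁻ w, ‖f (x + w)‖ₑ ^ q ∂ν :=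
    (ha.enorm.pow_const q).add hm3.lintegral_prod_right'
  have hL : ∫⁻ x, (∫⁻ w, ‖f (x + w) - average ν f x‖ₑ ^ q ∂ν) +
        ENNReal.ofReal C * ‖average ν f x‖ₑ ^ q ∂μ =
      (∫⁻ x, ∫⁻ w, ‖f (x + w) - average ν f x‖ₑ ^ q ∂ν ∂μ)
        + ENNReal.ofReal C * ∫⁻ x, ‖average ν f x‖ₑ ^ q ∂μ :=
    (lintegral_add_left hm2' _).trans
      (congrArg _ (lintegral_const_mul _ (ha.enorm.pow_const q)))
  have hR : ∫⁻ x, ENNReal.ofReal (η + C / 2) *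
        (‖average ν f x‖ₑ ^ q + ∫⁻ w, ‖f (x + w)‖ₑ ^ q ∂ν) ∂μ =
      ENNReal.ofReal (η + C / 2) *
        (∫⁻ x, ‖average ν f x‖ₑ ^ q ∂μ + ∫⁻ x, ‖f x‖ₑ ^ q ∂μ) :=
    (lintegral_const_mul _ hm4).trans (congrArg _ ((lintegral_add_left (ha.enorm.pow_const q) _).trans
      (congrArg _ (lintegral_lintegral_add μ ν (hf.enorm.pow_const q)))))
  refine hL.symm.le.trans (le_trans (lintegral_mono_ae (hJ.mono fun x hx => ?_)) hR.le)
  have hm1x : Measurable fun w => ‖(average ν f x + f (x + w)) / 2‖ₑ ^ q :=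
    ((((hfx x).const_add _).div_const 2).enorm).pow_const q
  have hm2x : Measurable fun w => ‖f (x + w) - average ν f x‖ₑ ^ q :=
    ((hfx x).sub_const _).enorm.pow_const q
  have hm3x : Measurable fun w => ‖f (x + w)‖ₑ ^ q := (hfx x).enorm.pow_const q
  calc (∫⁻ w, ‖f (x + w) - average ν f x‖ₑ ^ q ∂ν) + ENNReal.ofReal C * ‖average ν f x‖ₑ ^ q
      ≤ (∫⁻ w, ‖f (x + w) - average ν f x‖ₑ ^ q ∂ν) +
        ENNReal.ofReal C * ∫⁻ w, ‖(average ν f x + f (x + w)) / 2‖ₑ ^ q ∂ν :=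
      add_le_add le_rfl (mul_le_mul' le_rfl hx)
    _ = ∫⁻ w, (‖f (x + w) - average ν f x‖ₑ ^ q +
        ENNReal.ofReal C * ‖(average ν f x + f (x + w)) / 2‖ₑ ^ q) ∂ν :=
      ((lintegral_add_left hm2x _).trans (congrArg _ (lintegral_const_mul _ hm1x))).symm
    _ ≤ ∫⁻ w, ENNReal.ofReal (η + C / 2) * (‖average ν f x‖ₑ ^ q + ‖f (x + w)‖ₑ ^ q) ∂ν :=
      lintegral_mono fun w => H' (average ν f x) (f (x + w))
    _ = _ := by
      refine (lintegral_const_mul _ (hm3x.const_add _)).trans (congrArg _ ?_)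
      refine (lintegral_add_left measurable_const _).trans ?_
      rw [lintegral_const, measure_univ, mul_one]

/-- The function obtained from `f` by averaging successively along `ν 0, …, ν (j - 1)`. -/
def iteratedAverage (ν : ℕ → Measure E) (f : E → ℝ) : ℕ → E → ℝ
  | 0 => f
  | j + 1 => average (ν j) (iteratedAverage ν f j)

section
variable (ν : ℕ → Measure E) [∀ j, IsProbabilityMeasure (ν j)]

lemma measurable_iteratedAverage {f : E → ℝ} (hf : Measurable f) (j : ℕ) :
    Measurable (iteratedAverage ν f j) := by
  induction j with
  | zero => exact hf
  | succ j ih => exact measurable_average (ν j) ih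

lemma lintegral_iteratedAverage_rpow_le {q : ℝ} (hq : 1 ≤ q) {f : E → ℝ} (hf : Measurable f)
    (j : ℕ) : ∫⁻ x, ‖iteratedAverage ν f j x‖ₑ ^ q ∂μ ≤ ∫⁻ x, ‖f x‖ₑ ^ q ∂μ := by
  induction j with
  | zero => exact le_rfl
  | succ j ih =>
    exact (lintegral_average_rpow_le μ (ν j) hq (measurable_iteratedAverage ν hf j)).trans ih

end

/-- One of the first `N` decrements of a nonnegative sequence is at most `a 0 / N`. -/
lemma exists_lt_sub_le {N : ℕ} (hN : 0 < N) (a : ℕ → ℝ) (ha : ∀ j, 0 ≤ a j) :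
    ∃ j < N, a j - a (j + 1) ≤ a 0 / N := by
  by_contra! h
  have h1 : ∑ j ∈ Finset.range N, a 0 / N < ∑ j ∈ Finset.range N, (a j - a (j + 1)) :=
    Finset.sum_lt_sum_of_nonempty (by simpa using hN.ne') fun j hj => h j (Finset.mem_range.1 hj)
  rw [Finset.sum_range_sub', Finset.sum_const, Finset.card_range, nsmul_eq_mul,
    mul_div_cancel₀ _ (by positivity)] at h1
  linarith [ha N]

/-- Among `N` successive averages of any `f ∈ L^q` there is one that is nearly constant along the
measure used in the next averaging step; `N` depends only on `q` and on the precision `θ`, because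
the `L^q` norms decrease along the iteration and so one of the `N` decrements is at most
`‖f‖ ^ q / N`. -/
lemma exists_nearly_constant_average {q : ℝ} (hq : 1 < q) {θ : ℝ} (hθ : 0 < θ) :
    ∃ N : ℕ, ∀ (ν : ℕ → Measure E) [∀ j, IsProbabilityMeasure (ν j)] (f : E → ℝ),
      Measurable f → ∫⁻ x, ‖f x‖ₑ ^ q ∂μ ≠ ⊤ → ∃ j < N,
        ∫⁻ x, ∫⁻ w, ‖iteratedAverage ν f j (x + w) - iteratedAverage ν f (j + 1) x‖ₑ ^ q
          ∂(ν j) ∂μ ≤ ENNReal.ofReal θ * ∫⁻ x, ‖f x‖ₑ ^ q ∂μ := by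
  obtain ⟨C, hC, H⟩ := exists_uniform_convexity hq (η := θ / 4) (by positivity)
  obtain ⟨N, hN⟩ := exists_nat_gt (C / θ)
  have hN0 : (0 : ℝ) < N := lt_of_le_of_lt (by positivity) hN
  have hCN : C / N < θ := by
    rw [div_lt_iff₀ hθ] at hN
    rw [div_lt_iff₀ hN0]
    linarith
  refine ⟨N, fun ν _ f hf hfin => ?_⟩
  set a : ℕ → ℝ≥0∞ := fun j => ∫⁻ x, ‖iteratedAverage ν f j x‖ₑ ^ q ∂μ with ha
  have hale : ∀ j, a j ≤ a 0 := lintegral_iteratedAverage_rpow_le μ ν hq.le hf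
  have hafin : ∀ j, a j ≠ ⊤ := fun j => ne_top_of_le_ne_top hfin (hale j)
  obtain ⟨j, hj, hdec⟩ := exists_lt_sub_le (by exact_mod_cast hN0) (fun j => (a j).toReal)
    fun j => ENNReal.toReal_nonneg
  refine ⟨j, hj, ?_⟩
  have key := lintegral_sub_average_add_le μ (ν j) hq.le (by positivity) hC.le H
    (measurable_iteratedAverage ν hf j) (hafin j)
  set X := ∫⁻ x, ∫⁻ w, ‖iteratedAverage ν f j (x + w) - iteratedAverage ν f (j + 1) x‖ₑ ^ q
    ∂(ν j) ∂μ with hX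
  change X + ENNReal.ofReal C * a (j + 1) ≤ ENNReal.ofReal (θ / 4 + C / 2) * (a (j + 1) + a j) at key
  change X ≤ ENNReal.ofReal θ * a 0
  have hR : ENNReal.ofReal (θ / 4 + C / 2) * (a (j + 1) + a j) ≠ ⊤ :=
    ENNReal.mul_ne_top ENNReal.ofReal_ne_top (ENNReal.add_ne_top.2 ⟨hafin _, hafin _⟩)
  have hXfin : X ≠ ⊤ := ne_top_of_le_ne_top hR (le_self_add.trans key)
  have key' := ENNReal.toReal_mono hR key
  rw [ENNReal.toReal_add hXfin (ENNReal.mul_ne_top ENNReal.ofReal_ne_top (hafin _)),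
    ENNReal.toReal_mul, ENNReal.toReal_mul, ENNReal.toReal_add (hafin _) (hafin _),
    ENNReal.toReal_ofReal hC.le, ENNReal.toReal_ofReal (by positivity)] at key'
  rw [← ENNReal.toReal_le_toReal hXfin (ENNReal.mul_ne_top ENNReal.ofReal_ne_top (hafin 0)),
    ENNReal.toReal_mul, ENNReal.toReal_ofReal hθ.le]
  have h1 := ENNReal.toReal_mono (hafin 0) (hale j)
  have h2 := ENNReal.toReal_mono (hafin 0) (hale (j + 1))
  have h0 : 0 ≤ (a 0).toReal := ENNReal.toReal_nonneg
  have h3 : C / 2 * ((a j).toReal - (a (j + 1)).toReal) ≤ θ / 2 * (a 0).toReal := by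
    calc C / 2 * ((a j).toReal - (a (j + 1)).toReal) ≤ C / 2 * ((a 0).toReal / N) := by gcongr
      _ = C / N / 2 * (a 0).toReal := by ring
      _ ≤ θ / 2 * (a 0).toReal := by gcongr
  have h4 := mul_le_mul_of_nonneg_left (add_le_add h1 h2) (by positivity : 0 ≤ θ / 4)
  linarith

end

/-! ### Integral form of the commutator and its basic estimates -/

section

lemma lintegral_enorm_mul_enorm_le {α F G : Type*} [MeasurableSpace α] {μ : Measure α}
    [NormedAddCommGroup F] [NormedAddCommGroup G] {p q : ℝ≥0∞} [q.HolderConjugate p]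
    {f : α → F} {g : α → G} (hf : AEStronglyMeasurable f μ) (hg : AEStronglyMeasurable g μ) :
    ∫⁻ x, ‖f x‖ₑ * ‖g x‖ₑ ∂μ ≤ eLpNorm f q μ * eLpNorm g p μ := by
  have h := eLpNorm_smul_le_mul_eLpNorm (p := q) (q := p) (r := 1) hg.norm hf.norm
  rw [eLpNorm_norm, eLpNorm_norm, eLpNorm_one_eq_lintegral_enorm] at h
  simpa [enorm_mul] using h

variable {E : Type*} [NormedAddCommGroup E] [NormedSpace ℝ E] [FiniteDimensional ℝ E]
  [MeasurableSpace E] [BorelSpace E]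

/-- The commutator in integral form, `x ↦ ∫ ρ(x + z) k(z) · (u(x + z) - u(x)) dz`; the
DiPerna–Lions commutator is the case `k(z) = -∇φ_δ(-z)`. -/
def kernelCommutator (μ : Measure E) (k : E → E →L[ℝ] ℝ) (u : E → E) (ρ : E → ℝ) (x : E) : ℝ :=
  ∫ z, ρ (x + z) * k z (u (x + z) - u x) ∂μ

/-- `u` is Lipschitz with constant `M` in the `L^p` sense:
`‖u(· + h) - u‖_{L^p} ≤ |h| M` for all `h`. -/
def LpLipschitz (μ : Measure E) (u : E → E) (p M : ℝ≥0∞) : Prop :=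
  ∀ h, eLpNorm (fun x => u (x + h) - u x) p μ ≤ ‖h‖ₑ * M

variable {μ : Measure E} [μ.IsAddHaarMeasure] {p q : ℝ≥0∞} [q.HolderConjugate p]
  {k : E → E →L[ℝ] ℝ} {u : E → E} {M : ℝ≥0∞}

lemma measurable_comp_add {F : Type*} [MeasurableSpace F] {f : E → F} (hf : Measurable f) (z : E) :
    Measurable fun x => f (x + z) := hf.comp (measurable_id.add_const z)

lemma measurable_comp_add_prod {F : Type*} [MeasurableSpace F] {f : E → F} (hf : Measurable f) :
    Measurable fun y : E × E => f (y.1 + y.2) := hf.comp (measurable_fst.add measurable_snd)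

lemma eLpNorm_comp_add {F : Type*} [NormedAddCommGroup F] {f : E → F}
    (hf : AEStronglyMeasurable f μ) (z : E) (r : ℝ≥0∞) :
    eLpNorm (fun x => f (x + z)) r μ = eLpNorm f r μ :=
  eLpNorm_comp_measurePreserving hf (measurePreserving_add_right μ z)

/-- Tonelli's theorem and Hölder's inequality on each slice `z = const`. -/
lemma lintegral_lintegral_kernel_le (hum : Measurable u) (hu : LpLipschitz μ u p M)
    {κ : E → ℝ≥0∞} (hκ : Measurable κ) {f : E → E → ℝ} (hf : Measurable fun y : E × E => f y.1 y.2) :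
    ∫⁻ x, ∫⁻ z, κ z * (‖f x z‖ₑ * ‖u (x + z) - u x‖ₑ) ∂μ ∂μ
      ≤ ∫⁻ z, κ z * (eLpNorm (fun x => f x z) q μ * (‖z‖ₑ * M)) ∂μ := by
  have hm : Measurable (Function.uncurry fun x z : E =>
      κ z * (‖f x z‖ₑ * ‖u (x + z) - u x‖ₑ)) :=
    (hκ.comp measurable_snd).mul (hf.enorm.mul
      ((measurable_comp_add_prod hum).sub (hum.comp measurable_fst)).enorm)
  rw [lintegral_lintegral_swap hm.aemeasurable]
  refine lintegral_mono fun z => ?_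
  have hfz : Measurable fun x => f x z := hf.comp (measurable_id.prodMk measurable_const)
  have huz : Measurable fun x => u (x + z) - u x := (measurable_comp_add hum z).sub hum
  refine (lintegral_const_mul _ (hfz.enorm.mul huz.enorm)).le.trans ?_
  refine mul_le_mul_right ((lintegral_enorm_mul_enorm_le hfz.aestronglyMeasurable
    huz.aestronglyMeasurable).trans (mul_le_mul_right (hu z) _)) _

lemma enorm_integrand_le (a : ℝ) (L : E →L[ℝ] ℝ) (v : E) :
    ‖a * L v‖ₑ ≤ ‖L‖ₑ * (‖a‖ₑ * ‖v‖ₑ) := by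
  rw [enorm_mul]
  calc ‖a‖ₑ * ‖L v‖ₑ ≤ ‖a‖ₑ * (‖L‖ₑ * ‖v‖ₑ) := mul_le_mul_right (L.le_opENorm v) _
    _ = _ := by ring

lemma measurable_kernel_integrand (hk : Measurable k) (hum : Measurable u) {ρ : E → ℝ}
    (hρ : Measurable ρ) :
    Measurable fun y : E × E => ρ (y.1 + y.2) * k y.2 (u (y.1 + y.2) - u y.1) := by
  have h1 : Measurable fun y : E × E => k y.2 := hk.comp measurable_snd
  have h2 : Measurable fun y : E × E => u (y.1 + y.2) - u y.1 :=
    (measurable_comp_add_prod hum).sub (hum.comp measurable_fst)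
  have h3 : Continuous fun y : (E →L[ℝ] ℝ) × E => y.1 y.2 :=
    isBoundedBilinearMap_apply.continuous
  exact (measurable_comp_add_prod hρ).mul (h3.measurable.comp (h1.prodMk h2))

lemma lintegral_lintegral_integrand_le (hum : Measurable u) (hu : LpLipschitz μ u p M)
    (hk : Measurable k) {ρ : E → ℝ} (hρ : Measurable ρ) :
    ∫⁻ x, ∫⁻ z, ‖ρ (x + z) * k z (u (x + z) - u x)‖ₑ ∂μ ∂μ
      ≤ (∫⁻ z, ‖k z‖ₑ * ‖z‖ₑ ∂μ) * (eLpNorm ρ q μ * M) := by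
  calc _ ≤ ∫⁻ x, ∫⁻ z, ‖k z‖ₑ * (‖ρ (x + z)‖ₑ * ‖u (x + z) - u x‖ₑ) ∂μ ∂μ :=
        lintegral_mono fun x => lintegral_mono fun z => enorm_integrand_le _ _ _
    _ ≤ ∫⁻ z, ‖k z‖ₑ * (eLpNorm (fun x => ρ (x + z)) q μ * (‖z‖ₑ * M)) ∂μ :=
        lintegral_lintegral_kernel_le hum hu hk.enorm (measurable_comp_add_prod hρ)
    _ = ∫⁻ z, ‖k z‖ₑ * ‖z‖ₑ * (eLpNorm ρ q μ * M) ∂μ := by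
        refine lintegral_congr fun z => ?_
        rw [eLpNorm_comp_add hρ.aestronglyMeasurable]
        ring
    _ = _ := lintegral_mul_const _ (hk.enorm.mul measurable_enorm)

lemma ae_integrable_integrand (hum : Measurable u) (hu : LpLipschitz μ u p M)
    (hk : Measurable k) (hkfin : ∫⁻ z, ‖k z‖ₑ * ‖z‖ₑ ∂μ ≠ ⊤) (hM : M ≠ ⊤) {ρ : E → ℝ}
    (hρ : Measurable ρ) (hρfin : eLpNorm ρ q μ ≠ ⊤) :
    ∀ᵐ x ∂μ, Integrable (fun z => ρ (x + z) * k z (u (x + z) - u x)) μ := by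
  have hm := measurable_kernel_integrand hk hum hρ
  have h := lintegral_lintegral_integrand_le (q := q) hum hu hk hρ
  have hfin := ne_top_of_le_ne_top (ENNReal.mul_ne_top hkfin (ENNReal.mul_ne_top hρfin hM)) h
  filter_upwards [ae_lt_top hm.enorm.lintegral_prod_right' hfin] with x hx
  exact ⟨(hm.comp measurable_prodMk_left).aestronglyMeasurable, hx⟩

/-- Since the kernel has mean zero against the increments of `u`, a constant (depending on `x`) may
be subtracted from the density. -/
lemma enorm_kernelCommutator_le {ρ : E → ℝ} {x : E} (a : ℝ)
    (h0 : ∫ z, k z (u (x + z) - u x) ∂μ = 0)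
    (hi : Integrable (fun z => k z (u (x + z) - u x)) μ)
    (hρ : Integrable (fun z => ρ (x + z) * k z (u (x + z) - u x)) μ) :
    ‖kernelCommutator μ k u ρ x‖ₑ
      ≤ ∫⁻ z, ‖k z‖ₑ * (‖ρ (x + z) - a‖ₑ * ‖u (x + z) - u x‖ₑ) ∂μ := by
  have e : kernelCommutator μ k u ρ x = ∫ z, (ρ (x + z) - a) * k z (u (x + z) - u x) ∂μ := by
    simp only [sub_mul]
    rw [integral_sub hρ (hi.const_mul a), integral_const_mul, h0, mul_zero, sub_zero]
    rfl
  rw [e]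
  exact (enorm_integral_le_lintegral_enorm _).trans
    (lintegral_mono fun z => enorm_integrand_le _ _ _)

/-- The commutator of `u` with the fluctuation `ρ - average ν ρ` is estimated by the
modulus of continuity of the kernel `(x, z) ↦ k(z) · (u(x + z) - u(x))` in `z`, which is split into
the modulus of continuity of `k` and that of `u`. -/
lemma lintegral_kernelCommutator_sub_average_le (hum : Measurable u) (hu : LpLipschitz μ u p M)
    (hk : Measurable k) (hkfin : ∫⁻ z, ‖k z‖ₑ * ‖z‖ₑ ∂μ ≠ ⊤) (hM : M ≠ ⊤)
    {ρ : E → ℝ} (hρ : Measurable ρ) (hρfin : eLpNorm ρ q μ ≠ ⊤)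
    (ν : Measure E) [IsProbabilityMeasure ν] {c : ℝ≥0∞}
    (hc : ∀ᵐ w ∂ν, (∫⁻ z, ‖k z - k (z - w)‖ₑ * ‖z‖ₑ ∂μ) + (∫⁻ z, ‖k z‖ₑ ∂μ) * ‖w‖ₑ ≤ c) :
    ∫⁻ x, ‖kernelCommutator μ k u ρ x - kernelCommutator μ k u (average ν ρ) x‖ₑ ∂μ
      ≤ c * (eLpNorm ρ q μ * M) := by
  have hsw : ∀ w, Measurable fun x => ρ (x + w) := measurable_comp_add hρ
  have hm : Measurable fun y : E × E × E =>
      ρ (y.1 + y.2.2 + y.2.1) * k y.2.2 (u (y.1 + y.2.2) - u y.1) := by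
    have h3 : Continuous fun y : (E →L[ℝ] ℝ) × E => y.1 y.2 :=
      isBoundedBilinearMap_apply.continuous
    refine (hρ.comp ((measurable_fst.add measurable_snd.snd).add measurable_snd.fst)).mul
      (h3.measurable.comp ((hk.comp measurable_snd.snd).prodMk ?_))
    exact (hum.comp (measurable_fst.add measurable_snd.snd)).sub (hum.comp measurable_fst)
  have hprod : ∀ᵐ x ∂μ, Integrable (fun y : E × E =>
      ρ (x + y.2 + y.1) * k y.2 (u (x + y.2) - u x)) (ν.prod μ) := by
    have hfin : ∫⁻ x, ∫⁻ y, ‖ρ (x + y.2 + y.1) * k y.2 (u (x + y.2) - u x)‖ₑ ∂(ν.prod μ) ∂μ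
        ≠ ⊤ := by
      have h1 : ∀ x, ∫⁻ y, ‖ρ (x + y.2 + y.1) * k y.2 (u (x + y.2) - u x)‖ₑ ∂(ν.prod μ)
          = ∫⁻ w, ∫⁻ z, ‖ρ (x + z + w) * k z (u (x + z) - u x)‖ₑ ∂μ ∂ν := fun x =>
        lintegral_prod _ (hm.comp measurable_prodMk_left).enorm.aemeasurable
      simp_rw [h1]
      have h2 : Measurable (Function.uncurry fun x w : E =>
          ∫⁻ z, ‖ρ (x + z + w) * k z (u (x + z) - u x)‖ₑ ∂μ) := by
        have h3 : Measurable fun y : (E × E) × E =>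
            ‖ρ (y.1.1 + y.2 + y.1.2) * k y.2 (u (y.1.1 + y.2) - u y.1.1)‖ₑ :=
          hm.enorm.comp (measurable_fst.fst.prodMk (measurable_fst.snd.prodMk measurable_snd))
        exact h3.lintegral_prod_right'
      rw [lintegral_lintegral_swap h2.aemeasurable]
      refine ne_top_of_le_ne_top (ENNReal.mul_ne_top hkfin (ENNReal.mul_ne_top hρfin hM))
        ((lintegral_mono (g := fun _ => (∫⁻ z, ‖k z‖ₑ * ‖z‖ₑ ∂μ) * (eLpNorm ρ q μ * M))
          fun w => ?_).trans (by simp))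
      have h := lintegral_lintegral_integrand_le (q := q) hum hu hk (hsw w)
      rwa [eLpNorm_comp_add hρ.aestronglyMeasurable] at h
    filter_upwards [ae_lt_top hm.enorm.lintegral_prod_right' hfin] with x hx
    exact ⟨(hm.comp measurable_prodMk_left).aestronglyMeasurable, hx⟩
  -- for almost every `x`, write the difference as an average over `w` of integrals over `z`, and
  -- translate `z` by `w` to move the shift from `ρ` onto the kernel
  have hpt : ∀ᵐ x ∂μ, ‖kernelCommutator μ k u ρ x - kernelCommutator μ k u (average ν ρ) x‖ₑ
      ≤ ∫⁻ w, ∫⁻ z, (‖k z - k (z - w)‖ₑ * (‖ρ (x + z)‖ₑ * ‖u (x + z) - u x‖ₑ)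
        + ‖k (z - w)‖ₑ * (‖ρ (x + z)‖ₑ * ‖u (x + z) - u (x + (z - w))‖ₑ)) ∂μ ∂ν := by
    filter_upwards [hprod, ae_integrable_integrand (q := q) hum hu hk hkfin hM hρ hρfin]
      with x hx hx'
    have hshift : ∀ w, ∫ z, ρ (x + z + w) * k z (u (x + z) - u x) ∂μ
        = ∫ z, ρ (x + z) * k (z - w) (u (x + (z - w)) - u x) ∂μ := fun w => by
      rw [← integral_sub_right_eq_self (fun z => ρ (x + z + w) * k z (u (x + z) - u x)) w]
      refine integral_congr_ae (.of_forall fun z => ?_)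
      simp only [add_assoc, sub_add_cancel]
    have havg : kernelCommutator μ k u (average ν ρ) x
        = ∫ w, ∫ z, ρ (x + z + w) * k z (u (x + z) - u x) ∂μ ∂ν := by
      rw [integral_integral_swap hx]
      refine integral_congr_ae (.of_forall fun z => ?_)
      exact (integral_mul_const _ _).symm
    have hI : Integrable (fun w => ∫ z, ρ (x + z + w) * k z (u (x + z) - u x) ∂μ) ν :=
      hx.integral_prod_left
    have hdiff : kernelCommutator μ k u ρ x - kernelCommutator μ k u (average ν ρ) x
        = ∫ w, (kernelCommutator μ k u ρ x
          - ∫ z, ρ (x + z + w) * k z (u (x + z) - u x) ∂μ) ∂ν := by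
      rw [integral_sub (integrable_const _) hI, havg]
      simp
    rw [hdiff]
    refine (enorm_integral_le_lintegral_enorm _).trans (lintegral_mono_ae ?_)
    filter_upwards [hx.prod_right_ae] with w hw
    have hw' : Integrable (fun z => ρ (x + z) * k (z - w) (u (x + (z - w)) - u x)) μ := by
      have := hw.comp_sub_right w
      refine this.congr (.of_forall fun z => ?_)
      simp only [add_assoc, sub_add_cancel]
    rw [hshift, kernelCommutator, ← integral_sub hx' hw']
    refine (enorm_integral_le_lintegral_enorm _).trans (lintegral_mono fun z => ?_)
    have e : ρ (x + z) * k z (u (x + z) - u x)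
        - ρ (x + z) * k (z - w) (u (x + (z - w)) - u x)
        = ρ (x + z) * (k z - k (z - w)) (u (x + z) - u x)
          + ρ (x + z) * k (z - w) (u (x + z) - u (x + (z - w))) := by
      simp only [map_sub, sub_apply]
      ring
    rw [e]
    exact (enorm_add_le _ _).trans
      (add_le_add (enorm_integrand_le _ _ _) (enorm_integrand_le _ _ _))
  have hk' : ∀ w, Measurable fun z => k (z - w) := fun w => hk.comp (measurable_id.sub_const w)
  have hm2 : Measurable (Function.uncurry fun x w : E => ∫⁻ z,
      (‖k z - k (z - w)‖ₑ * (‖ρ (x + z)‖ₑ * ‖u (x + z) - u x‖ₑ)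
        + ‖k (z - w)‖ₑ * (‖ρ (x + z)‖ₑ * ‖u (x + z) - u (x + (z - w))‖ₑ)) ∂μ) := by
    have h3 : Measurable fun y : (E × E) × E =>
        ‖k y.2 - k (y.2 - y.1.2)‖ₑ * (‖ρ (y.1.1 + y.2)‖ₑ * ‖u (y.1.1 + y.2) - u y.1.1‖ₑ)
        + ‖k (y.2 - y.1.2)‖ₑ * (‖ρ (y.1.1 + y.2)‖ₑ *
          ‖u (y.1.1 + y.2) - u (y.1.1 + (y.2 - y.1.2))‖ₑ) := by
      fun_prop
    exact h3.lintegral_prod_right'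
  refine (lintegral_mono_ae hpt).trans ?_
  rw [lintegral_lintegral_swap hm2.aemeasurable]
  calc _ ≤ ∫⁻ _, c * (eLpNorm ρ q μ * M) ∂ν := lintegral_mono_ae ?_
    _ = _ := by simp
  filter_upwards [hc] with w hw
  refine le_trans ?_ (mul_le_mul_left hw _)
  have hsplit : ∀ x, ∫⁻ z, (‖k z - k (z - w)‖ₑ * (‖ρ (x + z)‖ₑ * ‖u (x + z) - u x‖ₑ)
        + ‖k (z - w)‖ₑ * (‖ρ (x + z)‖ₑ * ‖u (x + z) - u (x + (z - w))‖ₑ)) ∂μ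
      = (∫⁻ z, ‖k z - k (z - w)‖ₑ * (‖ρ (x + z)‖ₑ * ‖u (x + z) - u x‖ₑ) ∂μ)
        + ∫⁻ z, ‖k (z - w)‖ₑ * (‖ρ (x + z)‖ₑ * ‖u (x + z) - u (x + (z - w))‖ₑ) ∂μ := fun x =>
    lintegral_add_left (by fun_prop) _
  have hm3 : Measurable fun y : E × E =>
      ‖k y.2 - k (y.2 - w)‖ₑ * (‖ρ (y.1 + y.2)‖ₑ * ‖u (y.1 + y.2) - u y.1‖ₑ) := by fun_prop
  have hm4 : Measurable (Function.uncurry fun x z : E =>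
      ‖k (z - w)‖ₑ * (‖ρ (x + z)‖ₑ * ‖u (x + z) - u (x + (z - w))‖ₑ)) := by
    have : Measurable fun y : E × E =>
      ‖k (y.2 - w)‖ₑ * (‖ρ (y.1 + y.2)‖ₑ * ‖u (y.1 + y.2) - u (y.1 + (y.2 - w))‖ₑ) := by fun_prop
    exact this
  rw [lintegral_congr hsplit, lintegral_add_left hm3.lintegral_prod_right', add_mul]
  refine add_le_add ?_ ?_
  · have hκ : Measurable fun z => ‖k z - k (z - w)‖ₑ := (hk.sub (hk' w)).enorm
    refine (lintegral_lintegral_kernel_le (q := q) hum hu hκ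
      (measurable_comp_add_prod hρ)).trans (le_of_eq ?_)
    refine Eq.trans (lintegral_congr fun z => ?_)
      (lintegral_mul_const (eLpNorm ρ q μ * M) (hκ.mul measurable_enorm))
    rw [eLpNorm_comp_add hρ.aestronglyMeasurable]
    ring
  · rw [lintegral_lintegral_swap hm4.aemeasurable]
    calc _ ≤ ∫⁻ z, ‖k (z - w)‖ₑ * (eLpNorm ρ q μ * (‖w‖ₑ * M)) ∂μ := lintegral_mono fun z => ?_
      _ = _ := by
        rw [lintegral_mul_const _ (hk' w).enorm,
          lintegral_sub_right_eq_self (fun z => ‖k z‖ₑ) w]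
        ring
    have hmw : Measurable fun y => ‖ρ y‖ₑ * ‖u (y + -w) - u y‖ₑ := by fun_prop
    have hmz : Measurable fun x => ‖ρ (x + z)‖ₑ * ‖u (x + z) - u (x + (z - w))‖ₑ := by fun_prop
    have h1 : ∫⁻ x, ‖ρ (x + z)‖ₑ * ‖u (x + z) - u (x + (z - w))‖ₑ ∂μ
        = ∫⁻ y, ‖ρ y‖ₑ * ‖u (y + -w) - u y‖ₑ ∂μ := by
      rw [← lintegral_add_right_eq_self (fun y => ‖ρ y‖ₑ * ‖u (y + -w) - u y‖ₑ) z]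
      refine lintegral_congr fun x => ?_
      rw [enorm_sub_rev, add_assoc, sub_eq_add_neg z w]
    rw [lintegral_const_mul _ hmz, h1]
    refine mul_le_mul_right ((lintegral_enorm_mul_enorm_le (p := p) hρ.aestronglyMeasurable
      (g := fun y => u (y + -w) - u y) (by fun_prop)).trans (mul_le_mul_right ?_ _)) _
    simpa using hu (-w)

end

/-! ### Kernels at a given scale -/

section

variable {E : Type*} [NormedAddCommGroup E] [NormedSpace ℝ E] [FiniteDimensional ℝ E]
  [MeasurableSpace E] [BorelSpace E]

variable {μ : Measure E} [μ.IsAddHaarMeasure] {p q : ℝ≥0∞} [q.HolderConjugate p]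
  {k : E → E →L[ℝ] ℝ} {u : E → E} {M : ℝ≥0∞}

lemma eLpNorm_rpow_toReal {α F : Type*} [MeasurableSpace α] {μ : Measure α}
    [NormedAddCommGroup F] (hq : 1 < q) (hq' : q ≠ ⊤) (f : α → F) :
    eLpNorm f q μ ^ q.toReal = ∫⁻ x, ‖f x‖ₑ ^ q.toReal ∂μ := by
  have h0 : 0 < q.toReal := ENNReal.toReal_pos (zero_lt_one.trans hq).ne' hq'
  rw [eLpNorm_eq_lintegral_rpow_enorm_toReal (zero_lt_one.trans hq).ne' hq', ← ENNReal.rpow_mul,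
    one_div_mul_cancel h0.ne', ENNReal.rpow_one]

lemma one_lt_toReal (hq : 1 < q) (hq' : q ≠ ⊤) : 1 < q.toReal := by
  simpa using (ENNReal.toReal_lt_toReal ENNReal.one_ne_top hq').2 hq

/-- If `f(x + z)` is close in `L^q` to a function `a(x)` for most `z` in the set `S`, then the
commutator of `u` with `f` is small, up to the mass of the kernel outside `S`. -/
lemma lintegral_kernelCommutator_le (hum : Measurable u) (hu : LpLipschitz μ u p M)
    (hk : Measurable k) (hkfin : ∫⁻ z, ‖k z‖ₑ * ‖z‖ₑ ∂μ ≠ ⊤) (hM : M ≠ ⊤) (hq : 1 < q)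
    (hq' : q ≠ ⊤)
    (h0 : ∀ᵐ x ∂μ, Integrable (fun z => k z (u (x + z) - u x)) μ ∧
      ∫ z, k z (u (x + z) - u x) ∂μ = 0)
    {f a : E → ℝ} (hf : Measurable f) (hffin : eLpNorm f q μ ≠ ⊤) (ha : Measurable a)
    {S : Set E} (hS : MeasurableSet S) (hS0 : μ S ≠ 0) (hS1 : μ S ≠ ⊤) {b : ℝ≥0∞}
    (hb : ∀ z, ‖k z‖ₑ * ‖z‖ₑ ≤ b) :
    ∫⁻ x, ‖kernelCommutator μ k u f x‖ₑ ∂μ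
      ≤ (b * μ S * (∫⁻ x, ∫⁻ w, ‖f (x + w) - a x‖ₑ ^ q.toReal
            ∂(ProbabilityTheory.cond μ S) ∂μ) ^ (1 / q.toReal)
          + (∫⁻ z in Sᶜ, ‖k z‖ₑ * ‖z‖ₑ ∂μ) * (eLpNorm f q μ + eLpNorm a q μ)) * M := by
  have hQ : 1 < q.toReal := one_lt_toReal hq hq'
  have : IsProbabilityMeasure (ProbabilityTheory.cond μ S) :=
    ProbabilityTheory.cond_isProbabilityMeasure_of_finite hS0 hS1
  set g : E → ℝ≥0∞ := fun z => eLpNorm (fun x => f (x + z) - a x) q μ with hg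
  have hfa : Measurable fun y : E × E => f (y.1 + y.2) - a y.1 :=
    (measurable_comp_add_prod hf).sub (ha.comp measurable_fst)
  have hfa' : Measurable fun y : E × E => ‖f (y.2 + y.1) - a y.2‖ₑ ^ q.toReal :=
    ((hfa.comp measurable_swap).enorm).pow_const _
  have hgQ : ∀ z, g z ^ q.toReal = ∫⁻ x, ‖f (x + z) - a x‖ₑ ^ q.toReal ∂μ := fun z =>
    eLpNorm_rpow_toReal hq hq' _
  have hg' : g = fun z => (∫⁻ x, ‖f (x + z) - a x‖ₑ ^ q.toReal ∂μ) ^ (1 / q.toReal) := by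
    funext z
    rw [← hgQ, ← ENNReal.rpow_mul, mul_one_div_cancel (by linarith), ENNReal.rpow_one]
  have hgm : Measurable g := by
    rw [hg']
    exact hfa'.lintegral_prod_right'.pow_const _
  have hκ : Measurable fun z => ‖k z‖ₑ * ‖z‖ₑ := hk.enorm.mul measurable_enorm
  have hnear : ∫⁻ z in S, ‖k z‖ₑ * ‖z‖ₑ * g z ∂μ ≤ b * μ S * (∫⁻ x, ∫⁻ w,
      ‖f (x + w) - a x‖ₑ ^ q.toReal ∂(ProbabilityTheory.cond μ S) ∂μ) ^ (1 / q.toReal) := by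
    have h1 : ∫⁻ z in S, g z ∂μ = μ S * ∫⁻ z, g z ∂(ProbabilityTheory.cond μ S) := by
      rw [ProbabilityTheory.cond, lintegral_smul_measure, smul_eq_mul, ← mul_assoc,
        ENNReal.mul_inv_cancel hS0 hS1, one_mul]
    have h2 : (∫⁻ z, g z ∂(ProbabilityTheory.cond μ S)) ^ q.toReal
        ≤ ∫⁻ x, ∫⁻ w, ‖f (x + w) - a x‖ₑ ^ q.toReal ∂(ProbabilityTheory.cond μ S) ∂μ := by
      refine (rpow_lintegral_le _ hQ.le hgm).trans (le_of_eq ?_)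
      rw [lintegral_congr hgQ]
      exact lintegral_lintegral_swap hfa'.aemeasurable
    calc ∫⁻ z in S, ‖k z‖ₑ * ‖z‖ₑ * g z ∂μ ≤ ∫⁻ z in S, b * g z ∂μ :=
          lintegral_mono fun z => mul_le_mul_left (hb z) _
      _ = b * μ S * ∫⁻ z, g z ∂(ProbabilityTheory.cond μ S) := by
          rw [lintegral_const_mul _ hgm, h1, mul_assoc]
      _ ≤ _ := by
          refine mul_le_mul_right ?_ _
          have h3 := ENNReal.rpow_le_rpow h2 (by positivity : 0 ≤ 1 / q.toReal)
          rwa [← ENNReal.rpow_mul, mul_one_div_cancel (by linarith), ENNReal.rpow_one] at h3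
  have hfar : ∫⁻ z in Sᶜ, ‖k z‖ₑ * ‖z‖ₑ * g z ∂μ
      ≤ (∫⁻ z in Sᶜ, ‖k z‖ₑ * ‖z‖ₑ ∂μ) * (eLpNorm f q μ + eLpNorm a q μ) := by
    rw [← lintegral_mul_const _ hκ]
    refine lintegral_mono fun z => mul_le_mul_right ?_ _
    refine (eLpNorm_sub_le (measurable_comp_add hf z).aestronglyMeasurable
      ha.aestronglyMeasurable hq.le).trans ?_
    rw [eLpNorm_comp_add hf.aestronglyMeasurable]
  calc ∫⁻ x, ‖kernelCommutator μ k u f x‖ₑ ∂μ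
      ≤ ∫⁻ x, ∫⁻ z, ‖k z‖ₑ * (‖f (x + z) - a x‖ₑ * ‖u (x + z) - u x‖ₑ) ∂μ ∂μ := by
        refine lintegral_mono_ae ?_
        filter_upwards [h0, ae_integrable_integrand (q := q) hum hu hk hkfin hM hf hffin]
          with x hx hx'
        exact enorm_kernelCommutator_le (a x) hx.2 hx.1 hx'
    _ ≤ ∫⁻ z, ‖k z‖ₑ * (g z * (‖z‖ₑ * M)) ∂μ :=
        lintegral_lintegral_kernel_le hum hu hk.enorm (f := fun x z => f (x + z) - a x) hfa
    _ = (∫⁻ z, ‖k z‖ₑ * ‖z‖ₑ * g z ∂μ) * M := by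
        refine Eq.trans (lintegral_congr fun z => ?_) (lintegral_mul_const M (hκ.mul hgm))
        ring
    _ ≤ _ := by
        refine mul_le_mul_left ?_ _
        rw [← lintegral_add_compl _ hS]
        exact add_le_add hnear hfar

/-- The profile `δ^{-n-1} (1 + |z| / δ)^{-n-2}`, with `n` the dimension, that dominates the gradient
of a rescaled Schwartz function. -/
def decay (δ : ℝ) (z : E) : ℝ :=
  (δ ^ (Module.finrank ℝ E + 1))⁻¹ * ((1 + ‖δ⁻¹ • z‖) ^ (Module.finrank ℝ E + 2))⁻¹

/-- The integrable function `(1 + |z|)^{-n-1}`, with `n` the dimension. -/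
def tailDensity (z : E) : ℝ≥0∞ :=
  ENNReal.ofReal ((1 + ‖z‖) ^ (Module.finrank ℝ E + 1))⁻¹

lemma measurable_tailDensity : Measurable (tailDensity (E := E)) := by
  unfold tailDensity
  fun_prop

lemma lintegral_tailDensity_ne_top : ∫⁻ z, tailDensity z ∂μ ≠ ⊤ := by
  have h := integrable_one_add_norm (E := E) (μ := μ)
    (r := ((Module.finrank ℝ E + 1 : ℕ) : ℝ)) (by push_cast; linarith)
  have h2 := h.2.ne
  refine ne_of_eq_of_ne (lintegral_congr fun z => ?_) h2
  have h3 : (0 : ℝ) < 1 + ‖z‖ := by positivity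
  beta_reduce
  rw [Real.rpow_neg h3.le, Real.rpow_natCast, Real.enorm_of_nonneg (by positivity)]
  rfl

lemma lintegral_comp_inv_smul {δ : ℝ} (hδ : 0 < δ) {g : E → ℝ≥0∞} (hg : Measurable g) :
    ∫⁻ z, g (δ⁻¹ • z) ∂μ = ENNReal.ofReal (δ ^ Module.finrank ℝ E) * ∫⁻ z, g z ∂μ := by
  have h := Measure.map_addHaar_smul μ (inv_ne_zero hδ.ne')
  rw [← lintegral_map hg (measurable_const_smul _), h, lintegral_smul_measure, inv_pow, inv_inv,
    abs_of_pos (by positivity), smul_eq_mul]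

lemma decay_nonneg {δ : ℝ} (hδ : 0 < δ) (z : E) : 0 ≤ decay δ z := by
  unfold decay
  positivity

lemma decay_le {δ : ℝ} (hδ : 0 < δ) (z : E) :
    ENNReal.ofReal (decay δ z)
      ≤ ENNReal.ofReal (δ ^ (Module.finrank ℝ E + 1))⁻¹ * tailDensity (δ⁻¹ • z) := by
  rw [tailDensity, ← ENNReal.ofReal_mul (by positivity)]
  refine ENNReal.ofReal_le_ofReal ?_
  unfold decay
  gcongr
  · linarith [norm_nonneg (δ⁻¹ • z)]
  · norm_num

lemma decay_mul_norm_le {δ : ℝ} (hδ : 0 < δ) (z : E) :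
    ENNReal.ofReal (decay δ z) * ‖z‖ₑ
      ≤ ENNReal.ofReal (δ ^ Module.finrank ℝ E)⁻¹ * tailDensity (δ⁻¹ • z) := by
  rw [tailDensity, ← ENNReal.ofReal_mul (by positivity), ← ofReal_norm,
    ← ENNReal.ofReal_mul (decay_nonneg hδ z)]
  refine ENNReal.ofReal_le_ofReal ?_
  have h1 : ‖z‖ = δ * ‖δ⁻¹ • z‖ := by
    rw [norm_smul, norm_inv, Real.norm_of_nonneg hδ.le, mul_inv_cancel_left₀ hδ.ne']
  unfold decay
  set t := ‖δ⁻¹ • z‖ with ht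
  have ht0 : 0 ≤ t := norm_nonneg _
  rw [h1]
  calc (δ ^ (Module.finrank ℝ E + 1))⁻¹ * ((1 + t) ^ (Module.finrank ℝ E + 2))⁻¹ * (δ * t)
      ≤ (δ ^ (Module.finrank ℝ E + 1))⁻¹ * ((1 + t) ^ (Module.finrank ℝ E + 2))⁻¹
          * (δ * (1 + t)) := by
        gcongr
        linarith
    _ = _ := by
        field_simp
        ring

lemma lintegral_decay_le {δ : ℝ} (hδ : 0 < δ) :
    ∫⁻ z, ENNReal.ofReal (decay δ z) ∂μ ≤ ENNReal.ofReal δ⁻¹ * ∫⁻ z, tailDensity z ∂μ := by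
  refine (lintegral_mono (decay_le hδ)).trans (le_of_eq ?_)
  rw [lintegral_const_mul' _ _ ENNReal.ofReal_ne_top,
    lintegral_comp_inv_smul hδ measurable_tailDensity, ← mul_assoc,
    ← ENNReal.ofReal_mul (by positivity)]
  congr 2
  field_simp
  ring

lemma setLIntegral_decay_mul_norm_le {δ : ℝ} (hδ : 0 < δ) {A : Set E} (hA : MeasurableSet A) :
    ∫⁻ z in (fun z => δ⁻¹ • z) ⁻¹' A, ENNReal.ofReal (decay δ z) * ‖z‖ₑ ∂μ
      ≤ ∫⁻ z in A, tailDensity z ∂μ := by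
  refine (lintegral_mono (decay_mul_norm_le hδ)).trans (le_of_eq ?_)
  have hs : Measurable fun z : E => δ⁻¹ • z := measurable_const_smul _
  rw [lintegral_const_mul' _ _ ENNReal.ofReal_ne_top,
    ← lintegral_indicator (hs hA), ← lintegral_indicator hA,
    ← one_mul (∫⁻ z, A.indicator tailDensity z ∂μ)]
  have h := lintegral_comp_inv_smul (μ := μ) hδ (measurable_tailDensity.indicator hA)
  have h' : ∀ z, ((fun z : E => δ⁻¹ • z) ⁻¹' A).indicator (fun z => tailDensity (δ⁻¹ • z)) z
      = A.indicator tailDensity (δ⁻¹ • z) := fun z => rfl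
  rw [lintegral_congr h', h, ← mul_assoc, ← ENNReal.ofReal_mul (by positivity),
    inv_mul_cancel₀ (by positivity), ENNReal.ofReal_one]

lemma lintegral_decay_mul_norm_le {δ : ℝ} (hδ : 0 < δ) :
    ∫⁻ z, ENNReal.ofReal (decay δ z) * ‖z‖ₑ ∂μ ≤ ∫⁻ z, tailDensity z ∂μ := by
  simpa using setLIntegral_decay_mul_norm_le (μ := μ) hδ MeasurableSet.univ

lemma exists_setLIntegral_tailDensity_le {ε : ℝ≥0∞} (hε : 0 < ε) :
    ∃ Λ : ℝ, 1 ≤ Λ ∧ ∫⁻ z in (Metric.closedBall (0 : E) Λ)ᶜ, tailDensity z ∂μ ≤ ε := by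
  have h : Filter.Tendsto (fun n : ℕ => ∫⁻ z,
      ((Metric.closedBall (0 : E) n)ᶜ).indicator tailDensity z ∂μ) Filter.atTop
      (nhds (∫⁻ _, 0 ∂μ)) := by
    refine tendsto_lintegral_of_dominated_convergence tailDensity
      (fun n => measurable_tailDensity.indicator Metric.isClosed_closedBall.measurableSet.compl)
      (fun n => .of_forall fun z => indicator_le_self _ _ _) lintegral_tailDensity_ne_top
      (.of_forall fun z => ?_)
    obtain ⟨m, hm⟩ := exists_nat_ge ‖z‖
    refine tendsto_const_nhds.congr' ?_
    filter_upwards [Filter.eventually_ge_atTop m] with n hn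
    refine (indicator_of_notMem ?_ _).symm
    have : (m : ℝ) ≤ n := by exact_mod_cast hn
    simpa using hm.trans this
  rw [lintegral_zero] at h
  obtain ⟨n, hn, hn1⟩ := ((h.eventually_le_const hε).and (Filter.eventually_ge_atTop 1)).exists
  refine ⟨n, by exact_mod_cast hn1, ?_⟩
  rwa [lintegral_indicator Metric.isClosed_closedBall.measurableSet.compl] at hn

/-- The properties of `z ↦ -∇φ_δ(-z)` used below, for `φ` a Schwartz function: size and modulus of
continuity at the scale `δ`, with a constant `C` independent of `δ`. -/
structure IsKernelAtScale (C δ : ℝ) (k : E → E →L[ℝ] ℝ) : Prop where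
  measurable : Measurable k
  norm_le : ∀ z, ‖k z‖ ≤ C * decay δ z
  norm_sub_le : ∀ z w, ‖w‖ ≤ δ → ‖k z - k (z - w)‖ ≤ C * (‖w‖ / δ) * decay δ z

namespace IsKernelAtScale

variable {C δ : ℝ} (hk : IsKernelAtScale C δ k)
include hk

lemma enorm_le (hC : 0 ≤ C) (z : E) : ‖k z‖ₑ ≤ ENNReal.ofReal C * ENNReal.ofReal (decay δ z) := by
  rw [← ENNReal.ofReal_mul hC, ← ofReal_norm]
  exact ENNReal.ofReal_le_ofReal (hk.norm_le z)

lemma setLIntegral_le (hC : 0 ≤ C) (hδ : 0 < δ) {A : Set E} (hA : MeasurableSet A) :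
    ∫⁻ z in (fun z => δ⁻¹ • z) ⁻¹' A, ‖k z‖ₑ * ‖z‖ₑ ∂μ
      ≤ ENNReal.ofReal C * ∫⁻ z in A, tailDensity z ∂μ := by
  refine le_trans ?_ (mul_le_mul_right (setLIntegral_decay_mul_norm_le (μ := μ) hδ hA) _)
  rw [← lintegral_const_mul' _ _ ENNReal.ofReal_ne_top]
  refine lintegral_mono fun z => ?_
  rw [← mul_assoc]
  exact mul_le_mul_left (hk.enorm_le hC z) _

lemma lintegral_ne_top (hC : 0 ≤ C) (hδ : 0 < δ) : ∫⁻ z, ‖k z‖ₑ * ‖z‖ₑ ∂μ ≠ ⊤ := by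
  have h := hk.setLIntegral_le (μ := μ) hC hδ MeasurableSet.univ
  simp only [preimage_univ, setLIntegral_univ] at h
  exact ne_top_of_le_ne_top
    (ENNReal.mul_ne_top ENNReal.ofReal_ne_top lintegral_tailDensity_ne_top) h

lemma enorm_mul_enorm_le (hC : 0 ≤ C) (hδ : 0 < δ) (z : E) :
    ‖k z‖ₑ * ‖z‖ₑ ≤ ENNReal.ofReal (C * (δ ^ Module.finrank ℝ E)⁻¹) := by
  calc ‖k z‖ₑ * ‖z‖ₑ ≤ ENNReal.ofReal C * ENNReal.ofReal (decay δ z) * ‖z‖ₑ :=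
        mul_le_mul_left (hk.enorm_le hC z) _
    _ ≤ ENNReal.ofReal C *
        (ENNReal.ofReal (δ ^ Module.finrank ℝ E)⁻¹ * tailDensity (δ⁻¹ • z)) := by
        rw [mul_assoc]
        exact mul_le_mul_right (decay_mul_norm_le hδ z) _
    _ ≤ ENNReal.ofReal C * (ENNReal.ofReal (δ ^ Module.finrank ℝ E)⁻¹ * 1) := by
        gcongr
        rw [tailDensity, ENNReal.ofReal_le_one]
        refine inv_le_one_of_one_le₀ (one_le_pow₀ ?_)
        linarith [norm_nonneg (δ⁻¹ • z)]
    _ = _ := by rw [mul_one, ← ENNReal.ofReal_mul hC]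

lemma lintegral_modulus_le (hC : 0 ≤ C) (hδ : 0 < δ) {r : ℝ} (hr : r ≤ δ) {w : E} (hw : ‖w‖ ≤ r) :
    (∫⁻ z, ‖k z - k (z - w)‖ₑ * ‖z‖ₑ ∂μ) + (∫⁻ z, ‖k z‖ₑ ∂μ) * ‖w‖ₑ
      ≤ ENNReal.ofReal (2 * C * (r / δ)) * ∫⁻ z, tailDensity z ∂μ := by
  have hr0 : 0 ≤ r := (norm_nonneg w).trans hw
  have h1 : ∫⁻ z, ‖k z - k (z - w)‖ₑ * ‖z‖ₑ ∂μ
      ≤ ENNReal.ofReal (C * (r / δ)) * ∫⁻ z, tailDensity z ∂μ := by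
    refine le_trans ?_ (mul_le_mul_right (lintegral_decay_mul_norm_le (μ := μ) hδ) _)
    rw [← lintegral_const_mul' _ _ ENNReal.ofReal_ne_top]
    refine lintegral_mono fun z => ?_
    rw [← mul_assoc, ← ENNReal.ofReal_mul (by positivity), ← ofReal_norm (k z - k (z - w))]
    refine mul_le_mul_left (ENNReal.ofReal_le_ofReal ((hk.norm_sub_le z w (hw.trans hr)).trans ?_)) _
    have := decay_nonneg hδ z
    gcongr
  have h2 : (∫⁻ z, ‖k z‖ₑ ∂μ) * ‖w‖ₑ
      ≤ ENNReal.ofReal (C * (r / δ)) * ∫⁻ z, tailDensity z ∂μ := by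
    calc (∫⁻ z, ‖k z‖ₑ ∂μ) * ‖w‖ₑ
        ≤ (ENNReal.ofReal C * (ENNReal.ofReal δ⁻¹ * ∫⁻ z, tailDensity z ∂μ))
            * ENNReal.ofReal r := by
          refine mul_le_mul' ?_ (by rw [← ofReal_norm]; exact ENNReal.ofReal_le_ofReal hw)
          refine le_trans ?_ (mul_le_mul_right (lintegral_decay_le (μ := μ) hδ) _)
          rw [← lintegral_const_mul' _ _ ENNReal.ofReal_ne_top]
          exact lintegral_mono (hk.enorm_le hC)
      _ = _ := by
          rw [div_eq_mul_inv, ENNReal.ofReal_mul hC, ENNReal.ofReal_mul hr0]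
          ring
  refine (add_le_add h1 h2).trans (le_of_eq ?_)
  rw [← add_mul, ← ENNReal.ofReal_add (by positivity) (by positivity)]
  congr 2
  ring

end IsKernelAtScale

end

/-! ### The estimate for abstract kernels -/

section

variable {E : Type*} [NormedAddCommGroup E] [NormedSpace ℝ E] [FiniteDimensional ℝ E]
  [MeasurableSpace E] [BorelSpace E]

variable {μ : Measure E} [μ.IsAddHaarMeasure] {p q : ℝ≥0∞} [q.HolderConjugate p]
  {k : E → E →L[ℝ] ℝ} {u : E → E} {M : ℝ≥0∞}

lemma measurable_kernelCommutator (hk : Measurable k) (hum : Measurable u) {ρ : E → ℝ}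
    (hρ : Measurable ρ) : Measurable (kernelCommutator μ k u ρ) := by
  have h : StronglyMeasurable (Function.uncurry fun x z : E =>
      ρ (x + z) * k z (u (x + z) - u x)) :=
    (measurable_kernel_integrand hk hum hρ).stronglyMeasurable
  exact h.integral_prod_right.measurable

/-- Telescoping along the successive averages of `ρ`. -/
lemma lintegral_kernelCommutator_le_add_sum (hk : Measurable k) (hum : Measurable u)
    (ν : ℕ → Measure E) [∀ j, IsProbabilityMeasure (ν j)] {ρ : E → ℝ} (hρ : Measurable ρ) (j : ℕ) :
    ∫⁻ x, ‖kernelCommutator μ k u ρ x‖ₑ ∂μ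
      ≤ ∫⁻ x, ‖kernelCommutator μ k u (iteratedAverage ν ρ j) x‖ₑ ∂μ
        + ∑ i ∈ Finset.range j, ∫⁻ x, ‖kernelCommutator μ k u (iteratedAverage ν ρ i) x
            - kernelCommutator μ k u (iteratedAverage ν ρ (i + 1)) x‖ₑ ∂μ := by
  induction j with
  | zero => simp [iteratedAverage]
  | succ j ih =>
    have hm : ∀ i, Measurable (kernelCommutator μ k u (iteratedAverage ν ρ i)) := fun i =>
      measurable_kernelCommutator hk hum (measurable_iteratedAverage ν hρ i)
    refine ih.trans ?_
    rw [Finset.sum_range_succ, add_comm (∑ i ∈ _, _), ← add_assoc,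
      ← lintegral_add_left (hm (j + 1)).enorm]
    refine add_le_add (lintegral_mono fun x => ?_) le_rfl
    calc _ = ‖kernelCommutator μ k u (iteratedAverage ν ρ (j + 1)) x
          + (kernelCommutator μ k u (iteratedAverage ν ρ j) x
            - kernelCommutator μ k u (iteratedAverage ν ρ (j + 1)) x)‖ₑ := by
          rw [add_sub_cancel]
      _ ≤ _ := enorm_add_le _ _

lemma eLpNorm_iteratedAverage_le (hq : 1 < q) (hq' : q ≠ ⊤) (ν : ℕ → Measure E)
    [∀ j, IsProbabilityMeasure (ν j)] {ρ : E → ℝ} (hρ : Measurable ρ) (j : ℕ) :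
    eLpNorm (iteratedAverage ν ρ j) q μ ≤ eLpNorm ρ q μ := by
  have hQ := one_lt_toReal hq hq'
  rw [← ENNReal.rpow_le_rpow_iff (zero_lt_one.trans hQ), eLpNorm_rpow_toReal hq hq',
    eLpNorm_rpow_toReal hq hq']
  exact lintegral_iteratedAverage_rpow_le μ ν hQ.le hρ j

lemma sum_pow_div_pow_le {L : ℝ} (hL : 1 < L) (j : ℕ) :
    ∑ i ∈ Finset.range j, L ^ i / L ^ j ≤ (L - 1)⁻¹ := by
  have h1 : 0 < L - 1 := by linarith
  have h2 : 0 < L ^ j := by positivity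
  rw [← Finset.sum_div, geom_sum_eq hL.ne', div_div, div_le_iff₀ (by positivity)]
  field_simp
  linarith

/-- The commutator estimate for abstract kernels. The scales are `δ_j = δ_ε L ^ j` with a large ratio
`L`, and the density is averaged successively over balls of radius `Λ δ_j`. For a suitable `j` the
`j`-th average is nearly constant at scale `Λ δ_j`, whereas the fluctuations removed before live at
scales at most `Λ δ_j / L`. -/
theorem exists_scale_kernelCommutator_le (hq : 1 < q) (hq' : q ≠ ⊤) {C ε δbar : ℝ} (hC : 0 ≤ C)
    (hε : 0 < ε) (hδbar : 0 < δbar) :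
    ∃ δε : ℝ, 0 < δε ∧ δε ≤ δbar ∧
      ∀ (k : ℝ → E → E →L[ℝ] ℝ) (u : E → E) (M : ℝ≥0∞) (ρ : E → ℝ),
        (∀ δ, 0 < δ → IsKernelAtScale C δ (k δ)) → Measurable u →
        LpLipschitz μ u p M → M ≠ ⊤ →
        (∀ δ, 0 < δ → ∀ᵐ x ∂μ, Integrable (fun z => k δ z (u (x + z) - u x)) μ ∧
          ∫ z, k δ z (u (x + z) - u x) ∂μ = 0) →
        Measurable ρ → eLpNorm ρ q μ ≠ ⊤ →
        ∃ δ ∈ Icc δε δbar,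
          ∫⁻ x, ‖kernelCommutator μ (k δ) u ρ x‖ₑ ∂μ
            ≤ ENNReal.ofReal ε * (eLpNorm ρ q μ * M) := by
  have hQ := one_lt_toReal hq hq'
  have hQ0 : 0 < q.toReal := by linarith
  obtain ⟨Λ, hΛ, htail⟩ := exists_setLIntegral_tailDensity_le (E := E) (μ := μ)
    (ε := ENNReal.ofReal (ε / (6 * (C + 1)))) (ENNReal.ofReal_pos.2 (by positivity))
  set J : ℝ := (∫⁻ z, tailDensity z ∂μ).toReal with hJ
  have hJ0 : 0 ≤ J := ENNReal.toReal_nonneg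
  have hJ' : ∫⁻ z, tailDensity z ∂μ = ENNReal.ofReal J :=
    (ENNReal.ofReal_toReal lintegral_tailDensity_ne_top).symm
  set V : ℝ := (μ (Metric.closedBall (0 : E) 1)).toReal with hV
  have hV0 : 0 ≤ V := ENNReal.toReal_nonneg
  have hV' : μ (Metric.closedBall (0 : E) 1) = ENNReal.ofReal V :=
    (ENNReal.ofReal_toReal measure_closedBall_lt_top.ne).symm
  -- the mass of the near part of the kernel is at most `B`
  set B : ℝ := C * Λ ^ Module.finrank ℝ E * V with hB
  have hB0 : 0 ≤ B := by positivity
  set τ : ℝ := ε / (3 * (B + 1)) with hτ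
  have hτ0 : 0 < τ := by positivity
  obtain ⟨N, hN⟩ := exists_nearly_constant_average μ hQ (θ := τ ^ q.toReal) (by positivity)
  -- with this ratio the fluctuations, a geometric series, contribute at most `ε / 3`
  set L : ℝ := 1 + Λ + 6 * C * Λ * J / ε with hL
  have hΛ0 : 0 < Λ := by linarith
  have hLΛ : Λ ≤ L := by
    have : 0 ≤ 6 * C * Λ * J / ε := by positivity
    linarith
  have hL1 : 1 < L := by
    have : 0 ≤ 6 * C * Λ * J / ε := by positivity
    linarith
  have hL0 : 0 < L := by linarith
  refine ⟨δbar / L ^ N, by positivity, div_le_self hδbar.le (one_le_pow₀ hL1.le), ?_⟩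
  intro k u M ρ hk hum hu hM hzero hρ hρfin
  set δ : ℕ → ℝ := fun j => δbar / L ^ N * L ^ j with hδ
  have hδ0 : ∀ j, 0 < δ j := fun j => by positivity
  set S : ℕ → Set E := fun j => Metric.closedBall 0 (Λ * δ j) with hS
  have hSm : ∀ j, MeasurableSet (S j) := fun j => Metric.isClosed_closedBall.measurableSet
  have hS0 : ∀ j, μ (S j) ≠ 0 := fun j =>
    (Metric.measure_closedBall_pos μ 0 (by have := hδ0 j; positivity)).ne'
  have hS1 : ∀ j, μ (S j) ≠ ⊤ := fun j => measure_closedBall_lt_top.ne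
  set ν : ℕ → Measure E := fun j => ProbabilityTheory.cond μ (S j) with hν
  have : ∀ j, IsProbabilityMeasure (ν j) := fun j =>
    ProbabilityTheory.cond_isProbabilityMeasure_of_finite (hS0 j) (hS1 j)
  obtain ⟨j, hj, hX⟩ := hN ν ρ hρ (by
    rw [← eLpNorm_rpow_toReal hq hq']
    exact ENNReal.rpow_ne_top_of_nonneg hQ0.le hρfin)
  have hkj := hk (δ j) (hδ0 j)
  have hkfin := hkj.lintegral_ne_top (μ := μ) hC (hδ0 j)
  set A := eLpNorm ρ q μ with hA
  have hAi : ∀ i, eLpNorm (iteratedAverage ν ρ i) q μ ≤ A :=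
    eLpNorm_iteratedAverage_le hq hq' ν hρ
  have hρi : ∀ i, Measurable (iteratedAverage ν ρ i) := measurable_iteratedAverage ν hρ
  refine ⟨δ j, ⟨le_mul_of_one_le_right (by positivity) (one_le_pow₀ hL1.le), ?_⟩, ?_⟩
  · rw [hδ]
    dsimp only
    rw [div_mul_eq_mul_div, div_le_iff₀ (by positivity)]
    gcongr
    exact hL1.le
  -- the nearly constant average
  have hmain : ∫⁻ x, ‖kernelCommutator μ (k (δ j)) u (iteratedAverage ν ρ j) x‖ₑ ∂μ
      ≤ (ENNReal.ofReal (ε / 3) * A + ENNReal.ofReal (ε / 3) * A) * M := by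
    refine (lintegral_kernelCommutator_le hum hu hkj.measurable hkfin hM hq hq'
      (hzero _ (hδ0 j)) (hρi j) (ne_top_of_le_ne_top hρfin (hAi j)) (hρi (j + 1)) (hSm j) (hS0 j)
      (hS1 j) (hkj.enorm_mul_enorm_le hC (hδ0 j))).trans ?_
    refine mul_le_mul_left (add_le_add ?_ ?_) _
    · have hX' := ENNReal.rpow_le_rpow hX (by positivity : 0 ≤ 1 / q.toReal)
      rw [← eLpNorm_rpow_toReal hq hq', ENNReal.mul_rpow_of_nonneg _ _ (by positivity),
        ← ENNReal.rpow_mul, mul_one_div_cancel hQ0.ne', ENNReal.rpow_one,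
        ENNReal.ofReal_rpow_of_nonneg (by positivity) (by positivity), ← Real.rpow_mul hτ0.le,
        mul_one_div_cancel hQ0.ne', Real.rpow_one] at hX'
      refine (mul_le_mul_right hX' _).trans ?_
      rw [← mul_assoc]
      refine mul_le_mul_left ?_ _
      have hvol : μ (S j) = ENNReal.ofReal ((Λ * δ j) ^ Module.finrank ℝ E) * ENNReal.ofReal V := by
        have := hδ0 j
        rw [hS, Measure.addHaar_closedBall' μ _ (by positivity), hV']
      have hδj := hδ0 j
      rw [hvol, ← ENNReal.ofReal_mul (by positivity), ← ENNReal.ofReal_mul (by positivity),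
        ← ENNReal.ofReal_mul (by positivity)]
      refine ENNReal.ofReal_le_ofReal ?_
      calc C * (δ j ^ Module.finrank ℝ E)⁻¹ * ((Λ * δ j) ^ Module.finrank ℝ E * V) * τ
          = B * τ := by
            have hne : δ j ^ Module.finrank ℝ E ≠ 0 := by positivity
            have hmul : (Λ * δ j) ^ Module.finrank ℝ E
                = Λ ^ Module.finrank ℝ E * δ j ^ Module.finrank ℝ E := mul_pow _ _ _
            rw [hmul, hB]
            generalize δ j ^ Module.finrank ℝ E = t at hne ⊢
            field_simp
        _ ≤ (B + 1) * τ := by gcongr; linarith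
        _ = ε / 3 := by
            rw [hτ]
            field_simp
    · have hpre : (S j)ᶜ = (fun z => (δ j)⁻¹ • z) ⁻¹' (Metric.closedBall (0 : E) Λ)ᶜ := by
        ext z
        have hδj := hδ0 j
        simp only [hS, mem_compl_iff, Metric.mem_closedBall, dist_zero_right, mem_preimage,
          norm_smul, norm_inv, Real.norm_of_nonneg hδj.le]
        rw [inv_mul_le_iff₀ hδj, mul_comm]
      have hfar : ∫⁻ z in (S j)ᶜ, ‖k (δ j) z‖ₑ * ‖z‖ₑ ∂μ ≤ ENNReal.ofReal (ε / 6) := by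
        rw [hpre]
        refine (hkj.setLIntegral_le hC (hδ0 j)
          Metric.isClosed_closedBall.measurableSet.compl).trans ?_
        refine (mul_le_mul_right htail _).trans ?_
        rw [← ENNReal.ofReal_mul hC]
        refine ENNReal.ofReal_le_ofReal ?_
        rw [mul_div_assoc', div_le_div_iff₀ (by positivity) (by positivity)]
        nlinarith
      refine (mul_le_mul' hfar (add_le_add (hAi j) (hAi (j + 1)))).trans (le_of_eq ?_)
      rw [← two_mul, ← mul_assoc, ← ENNReal.ofReal_ofNat, ← ENNReal.ofReal_mul (by positivity)]
      congr 2
      ring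
  -- the fluctuations at smaller scales
  have hstep : ∀ i ∈ Finset.range j, ∫⁻ x, ‖kernelCommutator μ (k (δ j)) u (iteratedAverage ν ρ i) x
      - kernelCommutator μ (k (δ j)) u (iteratedAverage ν ρ (i + 1)) x‖ₑ ∂μ
      ≤ ENNReal.ofReal (2 * C * Λ * J * (L ^ i / L ^ j)) * (A * M) := by
    intro i hi
    have hij : i + 1 ≤ j := Finset.mem_range.1 hi
    have hratio : Λ * δ i / δ j = Λ * (L ^ i / L ^ j) := by
      rw [hδ]
      field_simp
    have hle : Λ * δ i ≤ δ j := by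
      have h1 : Λ * L ^ i ≤ L ^ j := by
        calc Λ * L ^ i ≤ L * L ^ i := by gcongr
          _ = L ^ (i + 1) := by ring
          _ ≤ L ^ j := pow_le_pow_right₀ hL1.le hij
      calc Λ * δ i = δbar / L ^ N * (Λ * L ^ i) := by
            rw [hδ]
            ring
        _ ≤ δ j := by
            rw [hδ]
            dsimp only
            gcongr
    have h := lintegral_kernelCommutator_sub_average_le (q := q) hum hu hkj.measurable hkfin hM
      (hρi i) (ne_top_of_le_ne_top hρfin (hAi i)) (ν i)
      (c := ENNReal.ofReal (2 * C * Λ * J * (L ^ i / L ^ j))) (by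
        have hmem : ∀ᵐ w ∂(ν i), w ∈ S i := ProbabilityTheory.ae_cond_mem (hSm i)
        filter_upwards [hmem] with w hw
        have hw' : ‖w‖ ≤ Λ * δ i := by simpa [hS] using hw
        refine (hkj.lintegral_modulus_le hC (hδ0 j) hle hw').trans (le_of_eq ?_)
        rw [hJ', ← ENNReal.ofReal_mul (by have := hδ0 i; have := hδ0 j; positivity), hratio]
        congr 1
        ring)
    exact h.trans (mul_le_mul_right (mul_le_mul_left (hAi i) _) _)
  refine (lintegral_kernelCommutator_le_add_sum hkj.measurable hum ν hρ j).trans ?_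
  refine (add_le_add hmain (Finset.sum_le_sum hstep)).trans ?_
  rw [← Finset.sum_mul, ← ENNReal.ofReal_sum_of_nonneg (fun i _ => by positivity),
    ← Finset.mul_sum]
  have hsum : 2 * C * Λ * J * ∑ i ∈ Finset.range j, L ^ i / L ^ j ≤ ε / 3 := by
    have h1 : 0 < L - 1 := by linarith
    have h2 : 6 * C * Λ * J ≤ ε * (L - 1) := by
      have e : ε * (L - 1) = ε * Λ + 6 * C * Λ * J := by
        rw [hL]
        field_simp
        ring
      have : 0 ≤ ε * Λ := by positivity
      linarith
    calc _ ≤ 2 * C * Λ * J * (L - 1)⁻¹ := by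
          gcongr
          exact sum_pow_div_pow_le hL1 j
      _ ≤ ε / 3 := by
          rw [← div_eq_mul_inv, div_le_iff₀ h1]
          linarith
  refine (add_le_add le_rfl (mul_le_mul_left (ENNReal.ofReal_le_ofReal hsum) _)).trans
    (le_of_eq ?_)
  have e : ENNReal.ofReal ε = ENNReal.ofReal (ε / 3) + ENNReal.ofReal (ε / 3)
      + ENNReal.ofReal (ε / 3) := by
    rw [← ENNReal.ofReal_add (by positivity) (by positivity),
      ← ENNReal.ofReal_add (by positivity) (by positivity)]
    congr 1
    ring
  rw [e]
  ring

end

/-! ### Difference quotients of Sobolev functions -/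

section

section Translation

variable {E : Type*} [NormedAddCommGroup E] [NormedSpace ℝ E] [FiniteDimensional ℝ E]
  [MeasurableSpace E] [BorelSpace E] {F : Type*} [NormedAddCommGroup F] [NormedSpace ℝ F]

variable {μ : Measure E} [μ.IsAddHaarMeasure] {p q : ℝ≥0∞} [q.HolderConjugate p]

instance : IsProbabilityMeasure (volume.restrict (Icc (0 : ℝ) 1)) := ⟨by simp⟩

/-- Fubini's theorem applies to a product of an `L^q` and an `L^p` function, translated at different
speeds. -/
lemma integrable_prod_translates {f : E → ℝ} {g : E → F} (hf : MemLp f q μ) (hg : MemLp g p μ)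
    (hfm : StronglyMeasurable f) (hgm : StronglyMeasurable g) (a b : E) :
    Integrable (fun y : E × ℝ => f (y.1 + y.2 • a) • g (y.1 + y.2 • b))
      (μ.prod (volume.restrict (Icc (0 : ℝ) 1))) := by
  have hma : ∀ c : E, Measurable fun y : E × ℝ => y.1 + y.2 • c := fun c => by fun_prop
  have hm : StronglyMeasurable fun y : E × ℝ => f (y.1 + y.2 • a) • g (y.1 + y.2 • b) :=
    (hfm.comp_measurable (hma a)).smul (hgm.comp_measurable (hma b))
  refine ⟨hm.aestronglyMeasurable, ?_⟩
  rw [HasFiniteIntegral, lintegral_prod_symm _ hm.enorm.aemeasurable]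
  have hle : ∀ s : ℝ, ∫⁻ x, ‖f (x + s • a) • g (x + s • b)‖ₑ ∂μ
      ≤ eLpNorm f q μ * eLpNorm g p μ := fun s => by
    have h := lintegral_enorm_mul_enorm_le (μ := μ) (p := p) (q := q)
      (f := fun x => f (x + s • a)) (g := fun x => g (x + s • b))
      (hfm.comp_measurable (measurable_add_const _)).aestronglyMeasurable
      (hgm.comp_measurable (measurable_add_const _)).aestronglyMeasurable
    rw [eLpNorm_comp_add hf.1, eLpNorm_comp_add hg.1] at h
    simpa only [enorm_smul] using h
  refine (lintegral_mono hle).trans_lt ?_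
  rw [lintegral_const, measure_univ, mul_one]
  exact ENNReal.mul_lt_top hf.2 hg.2

/-- Averaging the translates of `g` along a segment does not increase the `L^p` norm. -/
lemma eLpNorm_integral_translate_le (hp : 1 < p) (hp' : p ≠ ⊤) {g : E → F}
    (hgm : StronglyMeasurable g) (h : E) :
    eLpNorm (fun x => ∫ s in Icc (0 : ℝ) 1, g (x + s • h)) p μ ≤ eLpNorm g p μ := by
  have hP := one_lt_toReal hp hp'
  have hm : Measurable fun y : E × ℝ => ‖g (y.1 + y.2 • h)‖ₑ :=
    (hgm.comp_measurable (by fun_prop : Measurable fun y : E × ℝ => y.1 + y.2 • h)).enorm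
  rw [← ENNReal.rpow_le_rpow_iff (zero_lt_one.trans hP), eLpNorm_rpow_toReal hp hp',
    eLpNorm_rpow_toReal hp hp']
  calc ∫⁻ x, ‖∫ s in Icc (0 : ℝ) 1, g (x + s • h)‖ₑ ^ p.toReal ∂μ
      ≤ ∫⁻ x, ∫⁻ s in Icc (0 : ℝ) 1, ‖g (x + s • h)‖ₑ ^ p.toReal ∂volume ∂μ := by
        refine lintegral_mono fun x => ?_
        exact (ENNReal.rpow_le_rpow (enorm_integral_le_lintegral_enorm _)
          (zero_lt_one.trans hP).le).trans
          (rpow_lintegral_le _ hP.le (hm.comp measurable_prodMk_left))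
    _ = ∫⁻ s in Icc (0 : ℝ) 1, ∫⁻ x, ‖g (x + s • h)‖ₑ ^ p.toReal ∂μ ∂volume :=
        lintegral_lintegral_swap (hm.pow_const _).aemeasurable
    _ = ∫⁻ x, ‖g x‖ₑ ^ p.toReal ∂μ := by
        simp_rw [lintegral_add_right_eq_self (fun x => ‖g x‖ₑ ^ p.toReal)]
        rw [lintegral_const, measure_univ, mul_one]

end Translation

variable {d : ℕ} {p : ℝ≥0∞}
  {u : EuclideanSpace ℝ (Fin d) → EuclideanSpace ℝ (Fin d)}
  {G : EuclideanSpace ℝ (Fin d) → EuclideanSpace ℝ (Fin d) →L[ℝ] EuclideanSpace ℝ (Fin d)}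

/-- A function with weak gradient `G` satisfies `u(x + h) - u(x) = ∫₀¹ G(x + s h) h ds` for almost
every `x`; this is checked by testing against smooth functions. -/
lemma ae_sub_eq_integral_of_weak_gradient (q : ℝ≥0∞) [q.HolderConjugate p] (hp : 1 < p) (hp' : p ≠ ⊤)
    (hu : MemLp u p) (hG : MemLp G p) (hum : StronglyMeasurable u) (hGm : StronglyMeasurable G)
    (hw : ∀ ψ : EuclideanSpace ℝ (Fin d) → ℝ, ContDiff ℝ ∞ ψ → HasCompactSupport ψ →
      ∀ v, ∫ x, (fderiv ℝ ψ x v) • u x = - ∫ x, ψ x • G x v)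
    (h : EuclideanSpace ℝ (Fin d)) :
    ∀ᵐ x, u (x + h) - u x = ∫ s in Icc (0 : ℝ) 1, G (x + s • h) h := by
  have hGh : StronglyMeasurable fun x => G x h :=
    (ContinuousLinearMap.apply ℝ _ h).continuous.comp_stronglyMeasurable hGm
  have hGhp : MemLp (fun x => G x h) p :=
    (ContinuousLinearMap.apply ℝ (EuclideanSpace ℝ (Fin d)) h).comp_memLp' hG
  have hI : MemLp (fun x => ∫ s in Icc (0 : ℝ) 1, G (x + s • h) h) p := by
    refine ⟨?_, (eLpNorm_integral_translate_le hp hp' hGh h).trans_lt hGhp.2⟩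
    have hsm : StronglyMeasurable (Function.uncurry
        fun (x : EuclideanSpace ℝ (Fin d)) (s : ℝ) => G (x + s • h) h) :=
      hGh.comp_measurable (by fun_prop :
        Measurable fun y : EuclideanSpace ℝ (Fin d) × ℝ => y.1 + y.2 • h)
    exact hsm.integral_prod_right.aestronglyMeasurable
  have huh : MemLp (fun x => u (x + h)) p :=
    hu.comp_measurePreserving (measurePreserving_add_right volume h)
  refine ae_eq_of_integral_contDiff_smul_eq ((huh.sub hu).locallyIntegrable hp.le)
    (hI.locallyIntegrable hp.le) fun ψ hψ hψc => ?_
  have hψ1 : Differentiable ℝ ψ := hψ.differentiable (by simp)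
  have hψq : MemLp ψ q := hψ.continuous.memLp_of_hasCompactSupport hψc
  have hdψ : Continuous fun x => fderiv ℝ ψ x h :=
    (hψ.continuous_fderiv (by simp)).clm_apply continuous_const
  have hdψc : HasCompactSupport fun x => fderiv ℝ ψ x h := hψc.fderiv_apply ℝ h
  have hdψq : MemLp (fun x => fderiv ℝ ψ x h) q := hdψ.memLp_of_hasCompactSupport hdψc
  have hint : ∀ c : EuclideanSpace ℝ (Fin d), Integrable fun x => ψ (x - c) • u x := fun c => by
    have hc : MemLp (fun x => ψ (x - c)) q :=
      hψq.comp_measurePreserving (measurePreserving_sub_right volume c)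
    exact memLp_one_iff_integrable.1 (MemLp.smul (p := q) (q := p) (r := 1) hu hc)
  have hint' : Integrable fun x => ψ x • u x := by simpa using hint 0
  -- the fundamental theorem of calculus for the test function
  have hftc : ∀ x, ∫ s in Icc (0 : ℝ) 1, fderiv ℝ ψ (x + s • (-h)) h = ψ x - ψ (x - h) := by
    intro x
    have hd : ∀ s ∈ uIcc (0 : ℝ) 1, HasDerivAt (fun s : ℝ => ψ (x + s • (-h)))
        (fderiv ℝ ψ (x + s • (-h)) (-h)) s := fun s _ => by
      have h1 : HasDerivAt (fun s : ℝ => x + s • (-h)) (-h) s := by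
        simpa using ((hasDerivAt_id s).smul_const (-h)).const_add x
      exact (hψ1 _).hasFDerivAt.comp_hasDerivAt s h1
    have hc : Continuous fun s : ℝ => fderiv ℝ ψ (x + s • (-h)) (-h) :=
      ((hψ.continuous_fderiv (by simp)).comp (by fun_prop)).clm_apply continuous_const
    have h2 := intervalIntegral.integral_eq_sub_of_hasDerivAt hd (hc.intervalIntegrable 0 1)
    rw [intervalIntegral.integral_of_le zero_le_one, ← integral_Icc_eq_integral_Ioc] at h2
    simp only [map_neg, integral_neg, one_smul, zero_smul, add_zero, ← sub_eq_add_neg] at h2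
    simp only [← sub_eq_add_neg, smul_neg] at h2 ⊢
    linarith
  have hA : ∫ x, ψ x • (∫ s in Icc (0 : ℝ) 1, G (x + s • h) h)
      = ∫ s in Icc (0 : ℝ) 1, ∫ x, ψ x • G (x + s • h) h := by
    have hF := integrable_prod_translates (μ := volume) hψq hGhp
      hψ.continuous.stronglyMeasurable hGh 0 h
    simp only [smul_zero, add_zero] at hF
    rw [← integral_integral_swap (f := fun x s => ψ x • G (x + s • h) h) hF]
    exact integral_congr_ae (.of_forall fun x => (integral_smul _ _).symm)
  have hB : ∀ s : ℝ, ∫ x, ψ x • G (x + s • h) h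
      = - ∫ x, fderiv ℝ ψ (x + s • (-h)) h • u x := by
    intro s
    have h1 : ∫ x, ψ x • G (x + s • h) h = ∫ x, ψ (x + s • (-h)) • G x h := by
      rw [← integral_add_right_eq_self (fun x => ψ (x + s • (-h)) • G x h) (s • h)]
      simp
    have hsh : ContDiff ℝ ∞ fun x => ψ (x + s • (-h)) := hψ.comp (contDiff_id.add contDiff_const)
    have hshc : HasCompactSupport fun x => ψ (x + s • (-h)) :=
      hψc.comp_homeomorph (Homeomorph.addRight (s • (-h)))
    have h2 := hw _ hsh hshc h
    simp only [fderiv_comp_add_right] at h2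
    rw [h1, h2, neg_neg]
  have hC : ∫ s in Icc (0 : ℝ) 1, ∫ x, fderiv ℝ ψ (x + s • (-h)) h • u x
      = ∫ x, (ψ x - ψ (x - h)) • u x := by
    have hF := integrable_prod_translates (μ := volume) hdψq hu hdψ.stronglyMeasurable hum (-h) 0
    simp only [smul_zero, add_zero] at hF
    rw [← integral_integral_swap (f := fun x s => fderiv ℝ ψ (x + s • (-h)) h • u x) hF]
    refine integral_congr_ae (.of_forall fun x => ?_)
    dsimp only
    rw [integral_smul_const, hftc]
  have hD : ∫ x, ψ x • u (x + h) = ∫ x, ψ (x - h) • u x := by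
    rw [← integral_add_right_eq_self (fun x => ψ (x - h) • u x) h]
    simp
  have hint1 : Integrable fun x => ψ x • u (x + h) := by
    have := (hint h).comp_add_right h
    simpa using this
  rw [hA]
  simp only [hB, integral_neg, hC, smul_sub, sub_smul]
  rw [integral_sub hint1 hint', integral_sub hint' (hint h), hD, neg_sub]

/-- The difference quotients of a Sobolev function are bounded in `L^p` by its weak gradient. -/
lemma IsWeakGradient.lpLipschitz (hp : 1 < p) (hp' : p ≠ ⊤) (h : IsWeakGradient u G)
    (hu : MemLp u p) (hG : MemLp G p) (q : ℝ≥0∞) [q.HolderConjugate p] :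
    LpLipschitz volume u p (eLpNorm G p volume) := by
  intro v
  obtain ⟨u', hum, huu'⟩ := hu.1
  obtain ⟨G', hGm, hGG'⟩ := hG.1
  have key := ae_sub_eq_integral_of_weak_gradient q hp hp' (hu.ae_eq huu') (hG.ae_eq hGG')
    hum hGm (fun ψ hψ hψc w => by
      have h1 : ∫ x, (fderiv ℝ ψ x w) • u' x = ∫ x, (fderiv ℝ ψ x w) • u x :=
        integral_congr_ae (huu'.mono fun x hx => by dsimp only; rw [hx])
      have h2 : ∫ x, ψ x • G' x w = ∫ x, ψ x • G x w :=
        integral_congr_ae (hGG'.mono fun x hx => by dsimp only; rw [hx])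
      rw [h1, h2]
      exact h.integral_eq ψ hψ hψc w) v
  have hshift : ∀ᵐ x, u (x + v) = u' (x + v) :=
    (measurePreserving_add_right volume v).quasiMeasurePreserving.ae huu'
  have hGv : StronglyMeasurable fun x => G' x v :=
    (ContinuousLinearMap.apply ℝ _ v).continuous.comp_stronglyMeasurable hGm
  calc eLpNorm (fun x => u (x + v) - u x) p volume
      = eLpNorm (fun x => ∫ s in Icc (0 : ℝ) 1, G' (x + s • v) v) p volume := by
        refine eLpNorm_congr_ae ?_
        filter_upwards [key, hshift, huu'] with x h1 h2 h3
        rw [h2, h3, h1]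
    _ ≤ eLpNorm (fun x => G' x v) p volume := eLpNorm_integral_translate_le hp hp' hGv v
    _ ≤ ‖v‖ₑ * eLpNorm G' p volume := by
        have h1 := eLpNorm_le_mul_eLpNorm_of_ae_le_mul (μ := volume) (f := fun x => G' x v) (g := G')
          (c := ‖v‖) (.of_forall fun x => by rw [mul_comm]; exact (G' x).le_opNorm v) p
        rwa [ofReal_norm] at h1
    _ = _ := by rw [eLpNorm_congr_ae hGG']

end

/-! ### Schwartz functions as test functions and as kernels -/

section

variable {d : ℕ} {p q : ℝ≥0∞} [q.HolderConjugate p]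

lemma integrable_clm_apply {α V : Type*} [MeasurableSpace α] {μ : Measure α}
    [NormedAddCommGroup V] [NormedSpace ℝ V] {L : α → V →L[ℝ] ℝ} {v : α → V}
    (hL : MemLp L q μ) (hv : MemLp v p μ) : Integrable (fun y => L y (v y)) μ := by
  have h : Integrable (fun y => ‖L y‖ • ‖v y‖) μ :=
    memLp_one_iff_integrable.1 (MemLp.smul (p := q) (q := p) (r := 1) hv.norm hL.norm)
  refine h.mono' ?_ (.of_forall fun y => (L y).le_opNorm (v y))
  exact isBoundedBilinearMap_apply.continuous.comp_aestronglyMeasurable (hL.1.prodMk hv.1)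

lemma memLp_fderiv_sub_left (ψ : 𝓢(EuclideanSpace ℝ (Fin d), ℝ)) (x : EuclideanSpace ℝ (Fin d))
    (r : ℝ≥0∞) : MemLp (fun y => fderiv ℝ ψ (x - y)) r :=
  ((SchwartzMap.fderivCLM ℝ _ _ ψ).memLp r).comp_measurePreserving
    (Measure.measurePreserving_sub_left volume x)

lemma fderiv_comp_sub_left {V : Type*} [NormedAddCommGroup V] [NormedSpace ℝ V] (f : V → ℝ)
    (x y : V) : fderiv ℝ (fun y => f (x - y)) y = - fderiv ℝ f (x - y) := by
  have h : (fun y => f (x - y)) = fun y => (fun z => f (x + z)) ((-1 : ℝ) • y) := by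
    simp only [neg_one_smul, sub_eq_add_neg]
  rw [h, fderiv_comp_smul (f := fun z => f (x + z)) (-1 : ℝ), fderiv_comp_add_left, neg_one_smul,
    neg_one_smul, sub_eq_add_neg]

/-- Schwartz functions may be used as test functions for a divergence-free field in `L^p`: multiply
by the smooth cutoffs `χ(y / n)` and let `n` tend to infinity. -/
lemma IsDivergenceFree.integral_fderiv_sub_eq_zero
    {u : EuclideanSpace ℝ (Fin d) → EuclideanSpace ℝ (Fin d)} (hu : IsDivergenceFree u)
    (hup : MemLp u p) (q : ℝ≥0∞) [q.HolderConjugate p] (ψ : 𝓢(EuclideanSpace ℝ (Fin d), ℝ))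
    (x : EuclideanSpace ℝ (Fin d)) : ∫ y, fderiv ℝ ψ (x - y) (u y) = 0 := by
  let χ : ContDiffBump (0 : EuclideanSpace ℝ (Fin d)) := ⟨1, 2, one_pos, one_lt_two⟩
  have hχ : ContDiff ℝ ∞ χ := χ.contDiff
  obtain ⟨K, hK⟩ := (χ.hasCompactSupport.fderiv ℝ).exists_bound_of_continuous
    (hχ.continuous_fderiv (by simp))
  have hK0 : 0 ≤ K := (norm_nonneg _).trans (hK 0)
  set θ : EuclideanSpace ℝ (Fin d) → ℝ := fun y => ψ (x - y) with hθ
  have hθs : ContDiff ℝ ∞ θ := (ψ.smooth ⊤).comp (contDiff_const.sub contDiff_id)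
  have hθd : ∀ y, fderiv ℝ θ y = - fderiv ℝ ψ (x - y) := fderiv_comp_sub_left ψ x
  set c : ℕ → ℝ := fun n => ((n : ℝ) + 1)⁻¹ with hc
  have hc0 : ∀ n, 0 < c n := fun n => by positivity
  have hc1 : ∀ n, c n ≤ 1 := fun n => inv_le_one_of_one_le₀ (by linarith [n.cast_nonneg (α := ℝ)])
  have hclim : Filter.Tendsto c Filter.atTop (nhds 0) := by
    simpa [hc] using tendsto_one_div_add_atTop_nhds_zero_nat (𝕜 := ℝ)
  set η : ℕ → EuclideanSpace ℝ (Fin d) → ℝ := fun n y => χ (c n • y) with hη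
  have hηs : ∀ n, ContDiff ℝ ∞ (η n) := fun n => hχ.comp (contDiff_const_smul _)
  have hηd : ∀ n y, fderiv ℝ (η n) y = c n • fderiv ℝ χ (c n • y) := fun n y =>
    fderiv_comp_smul _
  have hηc : ∀ n, HasCompactSupport (η n) := fun n =>
    χ.hasCompactSupport.comp_homeomorph (Homeomorph.smulOfNeZero (c n) (hc0 n).ne')
  have hprod : ∀ n y, fderiv ℝ (fun y => θ y * η n y) y (u y)
      = θ y * (c n * fderiv ℝ χ (c n • y) (u y)) - η n y * fderiv ℝ ψ (x - y) (u y) := by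
    intro n y
    have h1 : DifferentiableAt ℝ θ y := (hθs.differentiable (by simp)) y
    have h2 : DifferentiableAt ℝ (η n) y := ((hηs n).differentiable (by simp)) y
    rw [fderiv_fun_mul h1 h2, hηd, hθd]
    simp
    ring
  have hzero : ∀ n, ∫ y, (θ y * (c n * fderiv ℝ χ (c n • y) (u y))
      - η n y * fderiv ℝ ψ (x - y) (u y)) = 0 := fun n => by
    rw [← hu.integral_eq_zero (fun y => θ y * η n y) (hθs.mul (hηs n)) ((hηc n).mul_left)]
    exact integral_congr_ae (.of_forall fun y => (hprod n y).symm)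
  have hθq : MemLp θ q :=
    (ψ.memLp q).comp_measurePreserving (Measure.measurePreserving_sub_left volume x)
  have hmain : Integrable fun y => fderiv ℝ ψ (x - y) (u y) :=
    integrable_clm_apply (memLp_fderiv_sub_left ψ x q) hup
  have hbd : Integrable fun y => ‖θ y‖ • ‖u y‖ :=
    memLp_one_iff_integrable.1 (MemLp.smul (p := q) (q := p) (r := 1) hup.norm hθq.norm)
  have hlim : Filter.Tendsto (fun n => ∫ y, (θ y * (c n * fderiv ℝ χ (c n • y) (u y))
      - η n y * fderiv ℝ ψ (x - y) (u y))) Filter.atTop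
      (nhds (∫ y, - fderiv ℝ ψ (x - y) (u y))) := by
    have hfd : ∀ n, AEStronglyMeasurable (fun y => fderiv ℝ χ (c n • y) (u y)) volume := fun n => by
      have h1 : Continuous fun y : EuclideanSpace ℝ (Fin d) => fderiv ℝ χ (c n • y) :=
        (hχ.continuous_fderiv (by simp)).comp (continuous_const_smul _)
      exact isBoundedBilinearMap_apply.continuous.comp_aestronglyMeasurable
        (h1.aestronglyMeasurable.prodMk hup.1)
    refine tendsto_integral_of_dominated_convergence
      (fun y => K * (‖θ y‖ • ‖u y‖) + ‖fderiv ℝ ψ (x - y) (u y)‖) (fun n => ?_)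
      ((hbd.const_mul K).add hmain.norm) (fun n => .of_forall fun y => ?_)
      (.of_forall fun y => ?_)
    · exact (hθs.continuous.aestronglyMeasurable.mul ((hfd n).const_mul _)).sub
        ((hηs n).continuous.aestronglyMeasurable.mul hmain.1)
    · refine (norm_sub_le _ _).trans (add_le_add ?_ ?_)
      · rw [norm_mul, norm_mul, Real.norm_of_nonneg (hc0 n).le, smul_eq_mul]
        calc ‖θ y‖ * (c n * ‖fderiv ℝ χ (c n • y) (u y)‖)
            ≤ ‖θ y‖ * (1 * (K * ‖u y‖)) := by
              gcongr
              · exact hc1 n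
              · exact ((fderiv ℝ χ (c n • y)).le_opNorm _).trans
                  (mul_le_mul_of_nonneg_right (hK _) (norm_nonneg _))
          _ = K * (‖θ y‖ * ‖u y‖) := by ring
      · rw [norm_mul]
        refine mul_le_of_le_one_left (norm_nonneg _) ?_
        rw [Real.norm_of_nonneg χ.nonneg]
        exact χ.le_one
    · have hcy : Filter.Tendsto (fun n => c n • y) Filter.atTop (nhds 0) := by
        simpa using hclim.smul_const y
      have h1 : Filter.Tendsto (fun n => η n y) Filter.atTop (nhds 1) := by
        have := (χ.continuous.tendsto 0).comp hcy
        rwa [χ.one_of_mem_closedBall (Metric.mem_closedBall_self χ.rIn_pos.le)] at this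
      have h2 : Filter.Tendsto (fun n => fderiv ℝ χ (c n • y) (u y)) Filter.atTop
          (nhds (fderiv ℝ χ 0 (u y))) := by
        have h3 : Continuous fun z => fderiv ℝ χ z (u y) :=
          (hχ.continuous_fderiv (by simp)).clm_apply continuous_const
        exact (h3.tendsto 0).comp hcy
      have h4 := ((hclim.mul h2).const_mul (θ y)).sub (h1.mul_const (fderiv ℝ ψ (x - y) (u y)))
      simpa using h4
  simp only [hzero] at hlim
  have h := tendsto_nhds_unique hlim tendsto_const_nhds
  rw [integral_neg, neg_eq_zero] at h
  exact h

lemma integral_fderiv_apply_eq_zero (ψ : 𝓢(EuclideanSpace ℝ (Fin d), ℝ))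
    (v : EuclideanSpace ℝ (Fin d)) : ∫ y, fderiv ℝ ψ y v = 0 := by
  have h1 : Integrable fun y => fderiv ℝ ψ y v :=
    (ContinuousLinearMap.apply ℝ ℝ v).integrable_comp (SchwartzMap.fderivCLM ℝ _ _ ψ).integrable
  have h := integral_mul_fderiv_eq_neg_fderiv_mul_of_integrable (μ := volume)
    (f := fun _ : EuclideanSpace ℝ (Fin d) => (1 : ℝ)) (g := ψ) (v := v)
    (by simp) (by simpa using h1) (by simpa using ψ.integrable)
    (by simp) (fun y _ => ψ.differentiableAt)
  simpa using h

/-- Schwartz functions decay faster than any power. -/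
lemma exists_norm_le_decay {F : Type*} [NormedAddCommGroup F] [NormedSpace ℝ F]
    (f : 𝓢(EuclideanSpace ℝ (Fin d), F)) (m : ℕ) :
    ∃ C : ℝ, 0 ≤ C ∧ ∀ z, ‖f z‖ ≤ C * ((1 + ‖z‖) ^ m)⁻¹ := by
  refine ⟨2 ^ m * ((Finset.Iic (m, 0)).sup fun m => SchwartzMap.seminorm ℝ m.1 m.2) f,
    by positivity, fun z => ?_⟩
  have h := SchwartzMap.one_add_le_sup_seminorm_apply (𝕜 := ℝ) (m := (m, 0)) (k := m) (n := 0)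
    le_rfl le_rfl f z
  rw [norm_iteratedFDeriv_zero] at h
  rw [← div_eq_mul_inv, le_div_iff₀ (by positivity), mul_comm]
  exact h

lemma inv_one_add_norm_pow_le {V : Type*} [NormedAddCommGroup V] {y z : V} (h : ‖y - z‖ ≤ 1)
    (m : ℕ) : ((1 + ‖y‖) ^ m)⁻¹ ≤ 2 ^ m * ((1 + ‖z‖) ^ m)⁻¹ := by
  have h1 : ‖z‖ ≤ ‖y‖ + 1 := by
    have := norm_sub_norm_le z y
    rw [norm_sub_rev] at this
    linarith
  rw [← div_eq_mul_inv, inv_le_iff_one_le_mul₀ (by positivity), div_mul_eq_mul_div,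
    le_div_iff₀ (by positivity), one_mul, ← mul_pow]
  gcongr
  linarith [norm_nonneg y]

/-- The increments of a Schwartz function decay as well, by the mean value inequality on the unit
ball around `z`. -/
lemma exists_norm_sub_le_decay {F : Type*} [NormedAddCommGroup F] [NormedSpace ℝ F]
    (f : 𝓢(EuclideanSpace ℝ (Fin d), F)) (m : ℕ) :
    ∃ C : ℝ, 0 ≤ C ∧ ∀ z v, ‖v‖ ≤ 1 → ‖f z - f (z + v)‖ ≤ C * ‖v‖ * ((1 + ‖z‖) ^ m)⁻¹ := by
  obtain ⟨C, hC, h⟩ := exists_norm_le_decay (SchwartzMap.fderivCLM ℝ _ _ f) m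
  refine ⟨C * 2 ^ m, by positivity, fun z v hv => ?_⟩
  have h1 : ∀ y ∈ Metric.closedBall z 1, ‖fderiv ℝ f y‖ ≤ C * (2 ^ m * ((1 + ‖z‖) ^ m)⁻¹) :=
    fun y hy => (h y).trans (mul_le_mul_of_nonneg_left
      (inv_one_add_norm_pow_le (by simpa [dist_eq_norm] using hy) m) hC)
  have h2 := (convex_closedBall z 1).norm_image_sub_le_of_norm_fderiv_le
    (fun y _ => f.differentiableAt) h1 (x := z + v) (y := z) (by simpa using hv)
    (Metric.mem_closedBall_self zero_le_one)
  refine h2.trans (le_of_eq ?_)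
  rw [show z - (z + v) = -v by abel, norm_neg]
  ring

end

/-! ### The commutator as a kernel integral -/

section

variable {d : ℕ} {p q : ℝ≥0∞} [q.HolderConjugate p]

/-- The rescaled mollifier is again a Schwartz function. -/
lemma exists_schwartz_eq_rescale (φ : 𝓢(EuclideanSpace ℝ (Fin d), ℝ)) {δ : ℝ} (hδ : 0 < δ) :
    ∃ ψ : 𝓢(EuclideanSpace ℝ (Fin d), ℝ), ⇑ψ = rescale φ δ := by
  refine ⟨(δ ^ d)⁻¹ • SchwartzMap.compCLMOfContinuousLinearEquiv ℝ
    (ContinuousLinearEquiv.smulLeft (Units.mk0 δ⁻¹ (inv_ne_zero hδ.ne'))) φ, ?_⟩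
  ext x
  simp [rescale]

lemma fderiv_rescale (φ : 𝓢(EuclideanSpace ℝ (Fin d), ℝ)) (δ : ℝ)
    (z : EuclideanSpace ℝ (Fin d)) :
    fderiv ℝ (rescale φ δ) z = (δ ^ (d + 1))⁻¹ • fderiv ℝ φ (δ⁻¹ • z) := by
  have h1 : rescale φ δ = fun x => (δ ^ d)⁻¹ • (fun x => φ (δ⁻¹ • x)) x := rfl
  have h2 : DifferentiableAt ℝ (fun x => φ (δ⁻¹ • x)) z :=
    (φ.differentiable.comp (differentiable_id.const_smul δ⁻¹)) z
  rw [h1, fderiv_fun_const_smul h2, fderiv_comp_smul, smul_smul, pow_succ, mul_inv]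

/-- The kernel `z ↦ -∇φ_δ(-z)` of the DiPerna–Lions commutator. -/
def gradientKernel (φ : EuclideanSpace ℝ (Fin d) → ℝ) (δ : ℝ) (z : EuclideanSpace ℝ (Fin d)) :
    EuclideanSpace ℝ (Fin d) →L[ℝ] ℝ := -fderiv ℝ (rescale φ δ) (-z)

/-- The commutator kernels of a Schwartz function satisfy the bounds at every scale, with one
constant. -/
lemma exists_isKernelAtScale (φ : 𝓢(EuclideanSpace ℝ (Fin d), ℝ)) :
    ∃ C : ℝ, 0 ≤ C ∧ ∀ δ, 0 < δ → IsKernelAtScale C δ (gradientKernel φ δ) := by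
  obtain ⟨C₁, hC₁, h₁⟩ := exists_norm_le_decay (SchwartzMap.fderivCLM ℝ _ _ φ) (d + 2)
  obtain ⟨C₂, hC₂, h₂⟩ := exists_norm_sub_le_decay (SchwartzMap.fderivCLM ℝ _ _ φ) (d + 2)
  simp only [SchwartzMap.fderivCLM_apply] at h₁ h₂
  refine ⟨C₁ + C₂, by positivity, fun δ hδ => ⟨?_, fun z => ?_, fun z w hw => ?_⟩⟩
  · obtain ⟨ψ, hψ⟩ := exists_schwartz_eq_rescale φ hδ
    have h : Continuous fun z => fderiv ℝ ψ z := (SchwartzMap.fderivCLM ℝ _ _ ψ).continuous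
    rw [hψ] at h
    exact (h.comp continuous_neg).neg.measurable
  · have h := h₁ (δ⁻¹ • (-z))
    have hn : ‖δ⁻¹ • (-z)‖ = ‖δ⁻¹ • z‖ := by rw [smul_neg, norm_neg]
    rw [hn] at h
    rw [gradientKernel, norm_neg, fderiv_rescale, norm_smul, Real.norm_of_nonneg (by positivity),
      decay, finrank_euclideanSpace_fin]
    calc _ ≤ (δ ^ (d + 1))⁻¹ * (C₁ * ((1 + ‖δ⁻¹ • z‖) ^ (d + 2))⁻¹) := by gcongr
      _ ≤ (δ ^ (d + 1))⁻¹ * ((C₁ + C₂) * ((1 + ‖δ⁻¹ • z‖) ^ (d + 2))⁻¹) := by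
          gcongr
          linarith
      _ = _ := by ring
  · have hw' : ‖δ⁻¹ • w‖ = ‖w‖ / δ := by
      rw [norm_smul, norm_inv, Real.norm_of_nonneg hδ.le]
      ring
    have h := h₂ (δ⁻¹ • (-z)) (δ⁻¹ • w) (by rw [hw', div_le_one hδ]; exact hw)
    have hn : ‖δ⁻¹ • (-z)‖ = ‖δ⁻¹ • z‖ := by rw [smul_neg, norm_neg]
    rw [hn, hw', ← smul_add, ← norm_neg] at h
    have e : gradientKernel φ δ z - gradientKernel φ δ (z - w)
        = (δ ^ (d + 1))⁻¹ •
          (-(fderiv ℝ φ (δ⁻¹ • (-z)) - fderiv ℝ φ (δ⁻¹ • (-z + w)))) := by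
      rw [gradientKernel, gradientKernel, fderiv_rescale, fderiv_rescale,
        show -(z - w) = -z + w by abel]
      module
    rw [e, norm_smul, Real.norm_of_nonneg (by positivity), decay, finrank_euclideanSpace_fin]
    calc _ ≤ (δ ^ (d + 1))⁻¹ * (C₂ * (‖w‖ / δ) * ((1 + ‖δ⁻¹ • z‖) ^ (d + 2))⁻¹) := by gcongr
      _ ≤ (δ ^ (d + 1))⁻¹ * ((C₁ + C₂) * (‖w‖ / δ) * ((1 + ‖δ⁻¹ • z‖) ^ (d + 2))⁻¹) := by
          gcongr
          linarith
      _ = _ := by ring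

/-- For a divergence-free field the commutator kernel has mean zero. -/
lemma IsDivergenceFree.integral_gradientKernel
    {u : EuclideanSpace ℝ (Fin d) → EuclideanSpace ℝ (Fin d)} (hu : IsDivergenceFree u)
    (hup : MemLp u p) (q : ℝ≥0∞) [q.HolderConjugate p] (φ : 𝓢(EuclideanSpace ℝ (Fin d), ℝ))
    {δ : ℝ} (hδ : 0 < δ) (x v : EuclideanSpace ℝ (Fin d)) :
    Integrable (fun z => gradientKernel φ δ z (u (x + z) - v)) ∧
      ∫ z, gradientKernel φ δ z (u (x + z) - v) = 0 := by
  obtain ⟨ψ, hψ⟩ := exists_schwartz_eq_rescale φ hδ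
  have hi1 : Integrable fun y => fderiv ℝ ψ (x - y) (u y) :=
    integrable_clm_apply (memLp_fderiv_sub_left ψ x q) hup
  have hi2 : Integrable fun y => fderiv ℝ ψ y v :=
    (ContinuousLinearMap.apply ℝ ℝ v).integrable_comp (SchwartzMap.fderivCLM ℝ _ _ ψ).integrable
  have e : (fun z => gradientKernel φ δ z (u (x + z) - v))
      = fun z => fderiv ℝ ψ (-z) v - fderiv ℝ ψ (x - (x + z)) (u (x + z)) := by
    funext z
    rw [gradientKernel, ← hψ, show x - (x + z) = -z by abel]
    simp
  have hi1' : Integrable fun z => fderiv ℝ ψ (x - (x + z)) (u (x + z)) := hi1.comp_add_left x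
  have hi2' : Integrable fun z => fderiv ℝ ψ (-z) v := hi2.comp_neg
  rw [e]
  refine ⟨hi2'.sub hi1', ?_⟩
  rw [integral_sub hi2' hi1',
    integral_add_left_eq_self (fun y => fderiv ℝ ψ (x - y) (u y)) x,
    hu.integral_fderiv_sub_eq_zero hup q ψ x,
    integral_neg_eq_self (fun z => fderiv ℝ ψ z v), integral_fderiv_apply_eq_zero, sub_zero]

/-- A function in `L^r`, `1 ≤ r < ∞`, is integrable against Schwartz decay, because
`t ≤ 1 + t ^ r`. -/
lemma integrable_decay_mul_norm {V : Type*} [NormedAddCommGroup V] {r : ℝ≥0∞} (hr : 1 ≤ r)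
    (hr' : r ≠ ⊤) {f : EuclideanSpace ℝ (Fin d) → V} (hf : MemLp f r)
    (x : EuclideanSpace ℝ (Fin d)) :
    Integrable fun t => ((1 + ‖x - t‖) ^ (d + 2))⁻¹ * ‖f t‖ := by
  have hr1 : 1 ≤ r.toReal := by simpa using ENNReal.toReal_mono hr' hr
  have h1 : Integrable fun t => ‖f t‖ ^ r.toReal :=
    hf.integrable_norm_rpow (zero_lt_one.trans_le hr).ne' hr'
  have h2 : Integrable fun t : EuclideanSpace ℝ (Fin d) => ((1 + ‖x - t‖) ^ (d + 2))⁻¹ := by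
    have h := integrable_one_add_norm (E := EuclideanSpace ℝ (Fin d)) (μ := volume)
      (r := ((d + 2 : ℕ) : ℝ)) (by rw [finrank_euclideanSpace_fin]; push_cast; linarith)
    refine (h.comp_sub_left x).congr (.of_forall fun t => ?_)
    dsimp only
    rw [Real.rpow_neg (by positivity), Real.rpow_natCast]
  have hc : Continuous fun t : EuclideanSpace ℝ (Fin d) => ((1 + ‖x - t‖) ^ (d + 2))⁻¹ := by
    refine Continuous.inv₀ (by fun_prop) fun t => ?_
    positivity
  refine (h2.add h1).mono' (hc.aestronglyMeasurable.mul hf.1.norm) (.of_forall fun t => ?_)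
  have ht : ‖f t‖ ≤ 1 + ‖f t‖ ^ r.toReal := by
    have h0 : 0 ≤ ‖f t‖ ^ r.toReal := by positivity
    rcases le_total ‖f t‖ 1 with h | h
    · linarith
    · linarith [Real.self_le_rpow_of_one_le h hr1]
  have hw : ((1 + ‖x - t‖) ^ (d + 2))⁻¹ ≤ 1 :=
    inv_le_one_of_one_le₀ (one_le_pow₀ (by linarith [norm_nonneg (x - t)]))
  rw [Real.norm_of_nonneg (by positivity)]
  calc ((1 + ‖x - t‖) ^ (d + 2))⁻¹ * ‖f t‖
      ≤ ((1 + ‖x - t‖) ^ (d + 2))⁻¹ * (1 + ‖f t‖ ^ r.toReal) := by gcongr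
    _ = ((1 + ‖x - t‖) ^ (d + 2))⁻¹ + ((1 + ‖x - t‖) ^ (d + 2))⁻¹ * ‖f t‖ ^ r.toReal := by ring
    _ ≤ ((1 + ‖x - t‖) ^ (d + 2))⁻¹ + ‖f t‖ ^ r.toReal := by
        gcongr
        exact mul_le_of_le_one_left (by positivity) hw

/-- Convolutions with a Schwartz function may be differentiated under the integral sign. -/
lemma hasFDerivAt_integral_smul {V : Type*} [NormedAddCommGroup V] [NormedSpace ℝ V]
    {r : ℝ≥0∞} (hr : 1 ≤ r) (hr' : r ≠ ⊤)
    {f : EuclideanSpace ℝ (Fin d) → V} (hf : MemLp f r)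
    (ψ : 𝓢(EuclideanSpace ℝ (Fin d), ℝ)) (x : EuclideanSpace ℝ (Fin d)) :
    Integrable (fun t => (fderiv ℝ ψ (x - t)).smulRight (f t)) ∧
      HasFDerivAt (fun x => ∫ t, ψ (x - t) • f t)
        (∫ t, (fderiv ℝ ψ (x - t)).smulRight (f t)) x := by
  obtain ⟨C₀, hC₀, h₀⟩ := exists_norm_le_decay ψ (d + 2)
  obtain ⟨C, hC, h⟩ := exists_norm_le_decay (SchwartzMap.fderivCLM ℝ _ _ ψ) (d + 2)
  simp only [SchwartzMap.fderivCLM_apply] at h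
  have hint := integrable_decay_mul_norm hr hr' hf x
  have hm : ∀ y, AEStronglyMeasurable (fun t => ψ (y - t) • f t) volume := fun y =>
    (ψ.continuous.comp (continuous_const.sub continuous_id)).aestronglyMeasurable.smul hf.1
  have hF : Integrable fun t => ψ (x - t) • f t := by
    refine (hint.const_mul C₀).mono' (hm x) (.of_forall fun t => ?_)
    rw [norm_smul, ← mul_assoc]
    exact mul_le_mul_of_nonneg_right (h₀ _) (norm_nonneg _)
  have hcont : Continuous fun t => fderiv ℝ ψ (x - t) :=
    (SchwartzMap.fderivCLM ℝ _ _ ψ).continuous.comp (continuous_const.sub continuous_id)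
  have hF'm : AEStronglyMeasurable (fun t => (fderiv ℝ ψ (x - t)).smulRight (f t)) volume :=
    (ContinuousLinearMap.smulRightL ℝ (EuclideanSpace ℝ (Fin d)) V).aestronglyMeasurable_comp₂
      hcont.aestronglyMeasurable hf.1
  have hbound : ∀ᵐ t, ∀ y ∈ Metric.ball x 1, ‖(fderiv ℝ ψ (y - t)).smulRight (f t)‖
      ≤ C * 2 ^ (d + 2) * (((1 + ‖x - t‖) ^ (d + 2))⁻¹ * ‖f t‖) := by
    refine .of_forall fun t y hy => ?_
    rw [ContinuousLinearMap.norm_smulRight_apply, ← mul_assoc, mul_assoc C]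
    refine mul_le_mul_of_nonneg_right ((h _).trans (mul_le_mul_of_nonneg_left
      (inv_one_add_norm_pow_le ?_ _) hC)) (norm_nonneg _)
    rw [sub_sub_sub_cancel_right, ← dist_eq_norm]
    exact (Metric.mem_ball.1 hy).le
  refine ⟨(hint.const_mul (C * 2 ^ (d + 2))).mono' hF'm (hbound.mono fun t ht =>
    ht x (Metric.mem_ball_self one_pos)), ?_⟩
  refine hasFDerivAt_integral_of_dominated_of_fderiv_le
    (F' := fun y t => (fderiv ℝ ψ (y - t)).smulRight (f t))
    (Metric.ball_mem_nhds x one_pos) (.of_forall hm) hF hF'm hbound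
    (hint.const_mul (C * 2 ^ (d + 2))) (.of_forall fun t y _ => ?_)
  have h1 : HasFDerivAt (fun y => ψ (y - t)) (fderiv ℝ ψ (y - t)) y :=
    ψ.differentiableAt.hasFDerivAt.comp y ((hasFDerivAt_id y).sub_const t)
  exact h1.smul_const (f t)

/-- The divergence at a point, as a linear function of the Jacobian matrix. -/
def traceCLM (d : ℕ) :
    (EuclideanSpace ℝ (Fin d) →L[ℝ] EuclideanSpace ℝ (Fin d)) →L[ℝ] ℝ :=
  ∑ i : Fin d, (EuclideanSpace.proj i).comp
    (ContinuousLinearMap.apply ℝ (EuclideanSpace ℝ (Fin d)) (EuclideanSpace.single i (1 : ℝ)))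

lemma traceCLM_smulRight (L : EuclideanSpace ℝ (Fin d) →L[ℝ] ℝ) (v : EuclideanSpace ℝ (Fin d)) :
    traceCLM d (L.smulRight v) = L v := by
  have hv : v = ∑ i : Fin d, v i • EuclideanSpace.single i (1 : ℝ) := by
    simpa using ((EuclideanSpace.basisFun (Fin d) ℝ).sum_repr v).symm
  conv_rhs => rw [hv, map_sum]
  simp [traceCLM, mul_comm]

/-- The DiPerna–Lions commutator in integral form. -/
lemma commutator_eq_kernelCommutator (hq : 1 ≤ q) (hq' : q ≠ ⊤)
    (φ : 𝓢(EuclideanSpace ℝ (Fin d), ℝ)) {δ : ℝ} (hδ : 0 < δ)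
    {u : EuclideanSpace ℝ (Fin d) → EuclideanSpace ℝ (Fin d)} (hu : MemLp u p)
    {ρ : EuclideanSpace ℝ (Fin d) → ℝ} (hρ : MemLp ρ q) (x : EuclideanSpace ℝ (Fin d)) :
    commutator φ δ u ρ x = kernelCommutator volume (gradientKernel φ δ) u ρ x := by
  obtain ⟨ψ, hψ⟩ := exists_schwartz_eq_rescale φ hδ
  have hρu : MemLp (fun y => ρ y • u y) 1 := MemLp.smul (p := q) (q := p) (r := 1) hu hρ
  obtain ⟨hi1, hd1⟩ := hasFDerivAt_integral_smul hq hq' hρ ψ x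
  obtain ⟨hi2, hd2⟩ := hasFDerivAt_integral_smul le_rfl ENNReal.one_ne_top hρu ψ x
  have e1 : convScalar ρ (rescale φ δ) = fun x => ∫ t, ψ (x - t) • ρ t := by
    funext x
    rw [convScalar, convolution_def, hψ]
    simp only [ContinuousLinearMap.lsmul_apply, smul_eq_mul, mul_comm]
  have e2 : convVector (fun y => ρ y • u y) (rescale φ δ)
      = fun x => ∫ t, ψ (x - t) • ρ t • u t := by
    funext x
    rw [convVector, convolution_def, hψ]
    simp only [ContinuousLinearMap.flip_apply, ContinuousLinearMap.lsmul_apply]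
  have h1 : fderiv ℝ (convScalar ρ (rescale φ δ)) x (u x)
      = ∫ t, fderiv ℝ ψ (x - t) (u x) * ρ t := by
    rw [e1, hd1.fderiv, ContinuousLinearMap.integral_apply hi1]
    simp
  have h2 : divergence (convVector (fun y => ρ y • u y) (rescale φ δ)) x
      = ∫ t, fderiv ℝ ψ (x - t) (ρ t • u t) := by
    have e3 : divergence (convVector (fun y => ρ y • u y) (rescale φ δ)) x
        = traceCLM d (fderiv ℝ (convVector (fun y => ρ y • u y) (rescale φ δ)) x) := by
      simp [divergence, traceCLM]
    rw [e3, e2, hd2.fderiv, ← ContinuousLinearMap.integral_comp_comm _ hi2]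
    simp only [traceCLM_smulRight]
  have hi1' : Integrable fun t => fderiv ℝ ψ (x - t) (u x) * ρ t := by
    simpa using (ContinuousLinearMap.apply ℝ ℝ (u x)).integrable_comp hi1
  have hi2' : Integrable fun t => fderiv ℝ ψ (x - t) (ρ t • u t) := by
    simpa only [traceCLM_smulRight] using (traceCLM d).integrable_comp hi2
  rw [commutator, h1, h2, ← integral_sub hi1' hi2', kernelCommutator,
    ← integral_add_left_eq_self _ x]
  refine integral_congr_ae (.of_forall fun z => ?_)
  dsimp only
  rw [gradientKernel, ← hψ, show x - (x + z) = -z by abel]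
  simp
  ring

end

/-! ### Conclusion -/

section

variable {d : ℕ} {p q : ℝ≥0∞}

lemma ne_top_of_inv_add_inv_eq_one (hq : 1 < q) (hpq : p⁻¹ + q⁻¹ = 1) : p ≠ ⊤ := by
  rintro rfl
  rw [ENNReal.inv_top, zero_add, ENNReal.inv_eq_one] at hpq
  exact hq.ne' hpq

lemma kernelCommutator_congr_ae {k : EuclideanSpace ℝ (Fin d) → EuclideanSpace ℝ (Fin d) →L[ℝ] ℝ}
    {u u' : EuclideanSpace ℝ (Fin d) → EuclideanSpace ℝ (Fin d)}
    {ρ ρ' : EuclideanSpace ℝ (Fin d) → ℝ} (hu : u =ᵐ[volume] u') (hρ : ρ =ᵐ[volume] ρ') :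
    kernelCommutator volume k u ρ =ᵐ[volume] kernelCommutator volume k u' ρ' := by
  filter_upwards [hu] with x hx
  have hq := (measurePreserving_add_left volume x).quasiMeasurePreserving
  refine integral_congr_ae ?_
  filter_upwards [hq.ae hu, hq.ae hρ] with z h1 h2
  rw [hx, h1, h2]

lemma LpLipschitz.congr_ae {u u' : EuclideanSpace ℝ (Fin d) → EuclideanSpace ℝ (Fin d)}
    {M : ℝ≥0∞} (h : LpLipschitz volume u p M) (hu : u =ᵐ[volume] u') :
    LpLipschitz volume u' p M := by
  intro v
  refine le_of_eq_of_le (eLpNorm_congr_ae ?_) (h v)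
  filter_upwards [hu, (measurePreserving_add_right volume v).quasiMeasurePreserving.ae hu]
    with x h1 h2
  rw [h1, h2]

end

end DiPernaLions

end

theorem proposition4p3 (d : ℕ) (hd : 1 ≤ d)
    (φ : 𝓢(EuclideanSpace ℝ (Fin d), ℝ)) (hφ : ∫ x, φ x = 1)
    (p q : ℝ≥0∞) (hp : 1 < p) (hq : 1 < q) (hpq : p⁻¹ + q⁻¹ = 1)
    (ε : ℝ) (hε : 0 < ε) (δbar : ℝ) (hδbar : 0 < δbar) :
    ∃ δε : ℝ, 0 < δε ∧ δε ≤ δbar ∧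
      ∀ (u : EuclideanSpace ℝ (Fin d) → EuclideanSpace ℝ (Fin d))
        (G : EuclideanSpace ℝ (Fin d) →
          EuclideanSpace ℝ (Fin d) →L[ℝ] EuclideanSpace ℝ (Fin d))
        (ρ : EuclideanSpace ℝ (Fin d) → ℝ),
        MemLp u p volume → DiPernaLions.IsWeakGradient u G → MemLp G p volume →
        DiPernaLions.IsDivergenceFree u → MemLp ρ q volume →
        (⨅ δ ∈ Set.Icc δε δbar, eLpNorm (DiPernaLions.commutator φ δ u ρ) 1 volume)
          ≤ ENNReal.ofReal ε * eLpNorm G p volume * eLpNorm ρ q volume := by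
  have hp' : p ≠ ⊤ := DiPernaLions.ne_top_of_inv_add_inv_eq_one hq hpq
  have hq' : q ≠ ⊤ := DiPernaLions.ne_top_of_inv_add_inv_eq_one hp (by rwa [add_comm])
  have : q.HolderConjugate p := ⟨by rw [inv_one, add_comm, hpq]⟩
  obtain ⟨C, hC, hk⟩ := DiPernaLions.exists_isKernelAtScale φ
  obtain ⟨δε, h0, h1, H⟩ := DiPernaLions.exists_scale_kernelCommutator_le
    (μ := (volume : Measure (EuclideanSpace ℝ (Fin d)))) (p := p) hq hq' hC hε hδbar
  refine ⟨δε, h0, h1, fun u G ρ hu hG hGp hdiv hρ => ?_⟩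
  obtain ⟨u', hum, huu'⟩ := hu.1
  obtain ⟨ρ', hρm, hρρ'⟩ := hρ.1
  obtain ⟨δ, hδ, hle⟩ := H (DiPernaLions.gradientKernel φ) u' (eLpNorm G p volume) ρ' hk
    hum.measurable ((hG.lpLipschitz hp hp' hu hGp q).congr_ae huu') hGp.2.ne
    (fun δ hδ => by
      filter_upwards [huu'] with x hx
      have hz := hdiv.integral_gradientKernel hu q φ hδ x (u x)
      have hae : (fun z => DiPernaLions.gradientKernel φ δ z (u (x + z) - u x))
          =ᵐ[volume] fun z => DiPernaLions.gradientKernel φ δ z (u' (x + z) - u' x) := by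
        filter_upwards [(measurePreserving_add_left volume x).quasiMeasurePreserving.ae huu']
          with z hzz
        rw [hx, hzz]
      exact ⟨hz.1.congr hae, (integral_congr_ae hae).symm.trans hz.2⟩)
    hρm.measurable (by rw [← eLpNorm_congr_ae hρρ']; exact hρ.2.ne)
  refine (iInf₂_le δ hδ).trans ?_
  have hcomm : DiPernaLions.commutator φ δ u ρ
      =ᵐ[volume] DiPernaLions.kernelCommutator volume (DiPernaLions.gradientKernel φ δ) u' ρ' := by
    rw [funext (DiPernaLions.commutator_eq_kernelCommutator hq.le hq' φ (h0.trans_le hδ.1) hu hρ)]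
    exact DiPernaLions.kernelCommutator_congr_ae huu' hρρ'
  rw [eLpNorm_congr_ae hcomm, eLpNorm_one_eq_lintegral_enorm, eLpNorm_congr_ae hρρ']
  refine hle.trans (le_of_eq ?_)
  ring
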